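/- All graphs are finite and simple; two edges are adjacent if they are distinct and share an endpoint. For a graph $G=(V,E)$, a set $F\subseteq E$ is an edge dominating set if every edge of $E\setminus F$ is adjacent to an edge of $F$, and a total edge dominating set if every edge of $E$ is adjacent to an edge of $F$; $\gamma'(G)$ and $\gamma'_t(G)$ denote the minimum cardinalities of such sets (with $\gamma'_t(G)=\infty$ if no total edge dominating set exists). A leaf is a vertex of degree one, and a leaf edge is an edge having a leaf as an endpoint. $E(v)$ is the set of edges incident with $v$. We consider trees whose edges are labelled with $S$, $L_1$, $L_2$ (an $X$-edge is an edge labelled $X$), up to isomorphism. In such a tree let $A_1$ be the set of vertices incident with exactly one $S$-edge, $A_2$ the set of vertices incident with at least two $S$-edges, $B$ the set of vertices $v$ such that all edges of $E(v)$ are $L_2$-edges, and $C$ the set of all other vertices. Let $\mathcal T_t$ be the smallest family of edge-labelled trees that contains every tree of diameter $4$, with non-leaf edges labelled $S$, leaf edges adjacent to at least two non-leaf edges labelled $L_2$, and all other leaf edges labelled $L_1$, and that is closed under the following operations on a tree $T\in\mathcal T_t$ with a vertex $v$ (old labels are kept, the $u_i$ are new vertices): * $\mathcal O_1$: if $v\in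 A_1\cup A_2$, add a vertex $u$ and the edge $vu$, labelled $L_1$ if $v\in A_1$ and $L_2$ if $v\in A_2$. * $\mathcal O_2$: if $v\in A_2$, add a path $u_1u_2$ and the edge $vu_1$; label $vu_1$ with $S$ and $u_1u_2$ with $L_1$. * $\mathcal O_3$: if $v\notin A_1$ and, in the case $v\in C$, each $L_1$-edge $vw$ in $E(v)$ is adjacent to a leaf edge or lies on a path $vwxy$ whose edges $vw,wx,xy$ are labelled $L_1,L_1,L_2$ and such that all edges of $E(x)$ except $wx$ are $L_2$-edges: add a path $u_1u_2u_3u_4u_5$ and the edge $vu_2$; label $u_2u_3,u_3u_4$ with $S$ and $vu_2,u_1u_2,u_4u_5$ with $L_1$. * $\mathcal O_4$: if $v\in B$, add a path $u_1u_2u_3u_4$ and the edge $vu_1$; label $vu_1,u_3u_4$ with $L_1$ and $u_1u_2,u_2u_3$ with $S$. * $\mathcal O_5$: for any $v$, add a path $u_1u_2u_3u_4u_5$ and the edge $vu_3$; label $vu_3$ with $L_2$, $u_1u_2,u_4u_5$ with $L_1$ and $u_2u_3,u_3u_4$ with $S$. **Theorem.** Let $T$ be a tree with at least two vertices. Then $\gamma'_t(T)=\gamma'(T)$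 if and only if $T$ has an edge labelling with which it belongs to $\mathcal T_t$. Moreover, for every edge-labelled tree in $\mathcal T_t$, the set of $S$-edges is a total edge dominating set of minimum cardinality $\gamma'_t(T)$. -/

import Mathlib

universe u

namespace EdgeDom

section Graphs

variable {V : Type u} (G : SimpleGraph V)

/-- Two edges are adjacent if they are distinct and share an endpoint. -/
def EdgeAdj (e f : Sym2 V) : Prop := e ≠ f ∧ ∃ v, v ∈ e ∧ v ∈ f

/-- Edge dominating set: a set `F` of edges such that every edge outside `F` is adjacent to
an edge of `F`. -/
def IsEDSet (F : Set (Sym2 V)) : Prop :=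
  F ⊆ G.edgeSet ∧ ∀ e ∈ G.edgeSet, e ∉ F → ∃ f ∈ F, EdgeAdj e f

/-- Total edge dominating set: a set `F` of edges such that every edge of the graph is adjacent to
an edge of `F`. -/
def IsTEDSet (F : Set (Sym2 V)) : Prop :=
  F ⊆ G.edgeSet ∧ ∀ e ∈ G.edgeSet, ∃ f ∈ F, EdgeAdj e f

/-- The edge domination number `γ'`. -/
noncomputable def edgeDomNumber : ℕ∞ := ⨅ F : {F : Set (Sym2 V) // IsEDSet G F}, F.1.encard

/-- The total edge domination number `γ'_t` (it is `⊤` if there is no total edge dominating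
set, that is, if some edge is adjacent to no other edge). -/
noncomputable def totalEdgeDomNumber : ℕ∞ :=
  ⨅ F : {F : Set (Sym2 V) // IsTEDSet G F}, F.1.encard

/-- A minimum total edge dominating set. -/
def IsMinTEDSet (F : Set (Sym2 V)) : Prop :=
  IsTEDSet G F ∧ F.encard = totalEdgeDomNumber G

/-- A leaf is a vertex of degree one. -/
def IsLeaf (v : V) : Prop := ∃! w, G.Adj v w

/-- A leaf edge is an edge with a leaf as an endpoint. -/
def IsLeafEdge (e : Sym2 V) : Prop := e ∈ G.edgeSet ∧ ∃ v ∈ e, IsLeaf G v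

/-- An edge that is not a leaf edge. -/
def IsNonLeafEdge (e : Sym2 V) : Prop := e ∈ G.edgeSet ∧ ¬ ∃ v ∈ e, IsLeaf G v

end Graphs

/-- The three edge labels. -/
inductive EdgeLabel
  | S
  | L1
  | L2

open EdgeLabel

/-- An edge-labelled simple graph on `V`: `lab a b = some ℓ` means that `ab` is an edge with
label `ℓ`, and `lab a b = none` that `a` and `b` are not adjacent. -/
structure LGraph (V : Type u) where
  lab : V → V → Option EdgeLabel
  symm : ∀ a b, lab a b = lab b a
  irrefl : ∀ a, lab a a = none

namespace LGraph

variable {V : Type u} (T : LGraph V)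

/-- The underlying simple graph. -/
def graph : SimpleGraph V where
  Adj a b := T.lab a b ≠ none
  symm := ⟨fun a b h => by rw [T.symm b a]; exact h⟩
  loopless := ⟨fun a h => h (T.irrefl a)⟩

/-- `D(T)`: the set of all `S`-edges. -/
def sEdges : Set (Sym2 V) := {e | ∃ a b, e = s(a, b) ∧ T.lab a b = some S}

/-- `A₁`: vertices incident with exactly one `S`-edge. -/
def classA1 : Set V := {v | ∃! w, T.lab v w = some S}

/-- `A₂`: vertices incident with at least two `S`-edges. -/
def classA2 : Set V := {v | ∃ w x, w ≠ x ∧ T.lab v w = some S ∧ T.lab v x = some S}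

/-- `B`: vertices all of whose incident edges are `L₂`-edges. -/
def classB : Set V := {v | ∀ w, T.graph.Adj v w → T.lab v w = some L2}

/-- `C`: all the other vertices. -/
def classC : Set V := ((T.classA1 ∪ T.classA2) ∪ T.classB)ᶜ

/-- The labelled path with vertices `0, 1, …, l.length`, the edge from `i` to `i + 1` being
labelled by the `i`-th entry of `l`. -/
def path (l : List EdgeLabel) : LGraph (Fin (l.length + 1)) where
  lab i j := if i.val + 1 = j.val then l[i.val]? else if j.val + 1 = i.val then l[j.val]? else none
  symm i j := by
    split_ifs <;> first | rfl | omega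
  irrefl i := by simp

open scoped Classical in
/-- The disjoint union of `T` and `P` together with one new edge labelled `ℓ` that joins the
vertex `v` of `T` to the vertex `p` of `P`. -/
noncomputable def join {W : Type} (v : V) (P : LGraph W) (p : W) (ℓ : EdgeLabel) :
    LGraph (V ⊕ W) where
  lab
    | .inl a, .inl b => T.lab a b
    | .inr i, .inr j => P.lab i j
    | .inl a, .inr i => if a = v ∧ i = p then some ℓ else none
    | .inr i, .inl a => if a = v ∧ i = p then some ℓ else none
  symm := by
    rintro (a | i) (b | j)
    · exact T.symm a b
    · rfl
    · rfl
    · exact P.symm i j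
  irrefl := by
    rintro (a | i)
    · exact T.irrefl a
    · exact P.irrefl i

/-- The initial labelling (used for trees of diameter 4): non-leaf edges are labelled `S`, leaf
edges adjacent to at least two non-leaf edges are labelled `L₂`, other leaf edges `L₁`. -/
def IsInitialLabelling : Prop :=
  ∀ a b, T.graph.Adj a b →
    (IsNonLeafEdge T.graph s(a, b) → T.lab a b = some S) ∧
    (IsLeafEdge T.graph s(a, b) →
      ((∃ f g, f ≠ g ∧ IsNonLeafEdge T.graph f ∧ IsNonLeafEdge T.graph g ∧
          EdgeAdj s(a, b) f ∧ EdgeAdj s(a, b) g) → T.lab a b = some L2) ∧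
      ((¬ ∃ f g, f ≠ g ∧ IsNonLeafEdge T.graph f ∧ IsNonLeafEdge T.graph g ∧
          EdgeAdj s(a, b) f ∧ EdgeAdj s(a, b) g) → T.lab a b = some L1))

/-- The side condition of the third operation at a vertex `v` of class `C`: each `L₁`-edge `vw` is
adjacent to a leaf edge, or lies on a path `v w x y` labelled `L₁, L₁, L₂` such that all edges at
`x` other than `wx` are `L₂`-edges. -/
def O3Condition (v : V) : Prop :=
  ∀ w, T.lab v w = some L1 →
    (∃ f, IsLeafEdge T.graph f ∧ EdgeAdj s(v, w) f) ∨
    (∃ x y, [v, w, x, y].Nodup ∧ T.lab w x = some L1 ∧ T.lab x y = some L2 ∧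
      ∀ z, T.graph.Adj x z → z ≠ w → T.lab x z = some L2)

end LGraph

open LGraph

/-- The family `𝒯_t` of edge-labelled trees (closed under isomorphism of labelled graphs). The new
vertices `u₁, u₂, …` of an operation are the vertices `0, 1, …` of the attached path. -/
inductive FamilyTt : ∀ {V : Type u}, LGraph V → Prop
  | initial {V : Type u} [Finite V] (T : LGraph V) (tree : T.graph.IsTree)
      (diam : T.graph.diam = 4) (lab : T.IsInitialLabelling) : FamilyTt T
  | iso {V W : Type u} (T : LGraph V) (T' : LGraph W) (e : V ≃ W)
      (he : ∀ a b, T'.lab (e a) (e b) = T.lab a b) (hT : FamilyTt T) : FamilyTt T'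
  | op1_A1 {V : Type u} (T : LGraph V) (v : V) (hT : FamilyTt T) (hv : v ∈ T.classA1) :
      FamilyTt (T.join v (path []) 0 L1)
  | op1_A2 {V : Type u} (T : LGraph V) (v : V) (hT : FamilyTt T) (hv : v ∈ T.classA2) :
      FamilyTt (T.join v (path []) 0 L2)
  | op2 {V : Type u} (T : LGraph V) (v : V) (hT : FamilyTt T) (hv : v ∈ T.classA2) :
      FamilyTt (T.join v (path [L1]) 0 S)
  | op3 {V : Type u} (T : LGraph V) (v : V) (hT : FamilyTt T) (hv : v ∉ T.classA1)
      (hC : v ∈ T.classC → T.O3Condition v) :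
      FamilyTt (T.join v (path [L1, S, S, L1]) 1 L1)
  | op4 {V : Type u} (T : LGraph V) (v : V) (hT : FamilyTt T) (hv : v ∈ T.classB) :
      FamilyTt (T.join v (path [S, S, L1]) 0 L1)
  | op5 {V : Type u} (T : LGraph V) (v : V) (hT : FamilyTt T) :
      FamilyTt (T.join v (path [L1, S, S, L1]) 2 L2)

end EdgeDom

/-!
Both halves of the theorem rest on an unlabelled description of the sets of `S`-edges, as *star
packings* of `G` (`IsStarPacking`): vertex-disjoint stars with at least two edges each, such that the
uncovered vertices are independent, the leaves of the stars are independent, and every leaf `w` has a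
private neighbour, an uncovered vertex with no other neighbour among the leaves. The set `A₁` is the
set of leaves of the stars and `A₂` the set of their centres.

A star packing has as many edges as leaves, and its edges form a total edge dominating set. Join each
leaf to a private neighbour: an edge of `G` can touch only one of these edges, so no edge
dominating set is smaller than the packing (`IsStarPacking.encard_le_of_isEDSet`). Hence `γ' = γ'_t`
and the packing is a minimum total edge dominating set, in any graph with a star packing.

Conversely, if `γ' = γ'_t` in a tree, then a minimum total edge dominating set is a star packing
(`exists_isStarPacking`). Each violated condition allows an exchange that yields a smaller edge
dominating set: an edge with both endpoints on further edges of the set could be deleted, two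
adjacent leaves could be joined to each other, and a leaf without private neighbour could be
uncovered by moving star edges onto its uncovered neighbours. Acyclicity ensures that every centre
remains covered.

The operations of the family are the ways in which a packed tree grows. Their conditions are phrased
with labels, but at an uncovered vertex the labels only record the kind of the neighbour: `L₁` for a
leaf of a star and `L₂` for a centre (`IsLabelledPacking`). In these terms each operation preserves
star packings (`FamilyTt.isLabelledPacking`). To obtain every packed tree
(`IsStarPacking.hasFamilyLabelling`), root it at a centre and choose a deepest star. Everything below
it is a pendant uncovered vertex, so that the star meets the rest of the tree in a single edge. Surplus
pendant vertices and leaves are removed by undoing the first two operations; what is left of the star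
was attached by the fifth operation if its edge to the rest starts at the centre, and by the third or
the fourth one if it starts at a leaf. A tree packed by a single star has diameter four and
is where the construction starts.
-/

namespace EdgeDom

open EdgeLabel LGraph

/-! ### Star packings and the lower bound -/

/-- `D` is a star packing of `G`: the edges of `D` form vertex-disjoint stars with leaf set `A₁` and
centre set `A₂`, each with at least two leaves; the uncovered vertices, those outside `A₁ ∪ A₂`,
are independent in `G`, and so is `A₁`; and every leaf of a star has a private neighbour, an uncovered
vertex with no other neighbour in `A₁`. -/
structure IsStarPacking {V : Type u} (G D : SimpleGraph V) (A₁ A₂ : Set V) : Prop where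
  le : ∀ {a b}, D.Adj a b → G.Adj a b
  adj_cases : ∀ {a b}, D.Adj a b → (a ∈ A₁ ∧ b ∈ A₂) ∨ (a ∈ A₂ ∧ b ∈ A₁)
  leaf : ∀ {a}, a ∈ A₁ → ∃! c, D.Adj a c
  centre : ∀ {c}, c ∈ A₂ → ∃ w w', w ≠ w' ∧ D.Adj c w ∧ D.Adj c w'
  cover : ∀ {a b}, G.Adj a b → a ∈ A₁ ∨ a ∈ A₂ ∨ b ∈ A₁ ∨ b ∈ A₂
  indep : ∀ {a b}, a ∈ A₁ → b ∈ A₁ → ¬ G.Adj a b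
  priv : ∀ {w}, w ∈ A₁ → ∃ x, x ∉ A₁ ∧ x ∉ A₂ ∧ G.Adj w x ∧ ∀ w' ∈ A₁, G.Adj w' x → w' = w

namespace IsStarPacking

variable {V : Type u} {G D : SimpleGraph V} {A₁ A₂ : Set V}

theorem not_mem_both (h : IsStarPacking G D A₁ A₂) {v : V} (h₁ : v ∈ A₁) (h₂ : v ∈ A₂) : False := by
  obtain ⟨w, w', hne, hw, hw'⟩ := h.centre h₂
  exact hne ((h.leaf h₁).unique hw hw')

theorem mem_right_of_mem_left (h : IsStarPacking G D A₁ A₂) {w c : V} (hw : w ∈ A₁)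
    (hc : D.Adj w c) : c ∈ A₂ := by
  rcases h.adj_cases hc with h' | h'
  · exact h'.2
  · exact (h.not_mem_both hw h'.1).elim

theorem mem_left_of_mem_right (h : IsStarPacking G D A₁ A₂) {w c : V} (hc : c ∈ A₂)
    (hw : D.Adj c w) : w ∈ A₁ := by
  rcases h.adj_cases hw with h' | h'
  · exact (h.not_mem_both h'.1 hc).elim
  · exact h'.2

theorem not_adj_of_uncovered (h : IsStarPacking G D A₁ A₂) {v w : V} (h₁ : v ∉ A₁)
    (h₂ : v ∉ A₂) : ¬ D.Adj v w := by
  intro hd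
  rcases h.adj_cases hd with h' | h'
  exacts [h₁ h'.1, h₂ h'.1]

theorem exists_adj (h : IsStarPacking G D A₁ A₂) {v : V} (hv : v ∈ A₁ ∨ v ∈ A₂) :
    ∃ w, D.Adj v w := by
  rcases hv with hv | hv
  · exact (h.leaf hv).exists
  · obtain ⟨w, _, _, hw, _⟩ := h.centre hv
    exact ⟨w, hw⟩

theorem mem_left_iff (h : IsStarPacking G D A₁ A₂) {v : V} : v ∈ A₁ ↔ ∃! w, D.Adj v w := by
  refine ⟨fun hv => h.leaf hv, fun hv => ?_⟩
  obtain ⟨w, hw, hu⟩ := hv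
  rcases h.adj_cases hw with h' | h'
  · exact h'.1
  · obtain ⟨x, y, hne, hx, hy⟩ := h.centre h'.1
    exact (hne ((hu x hx).trans (hu y hy).symm)).elim

theorem mem_right_iff (h : IsStarPacking G D A₁ A₂) {v : V} :
    v ∈ A₂ ↔ ∃ w x, w ≠ x ∧ D.Adj v w ∧ D.Adj v x := by
  refine ⟨fun hv => h.centre hv, ?_⟩
  rintro ⟨w, x, hne, hw, hx⟩
  rcases h.adj_cases hw with h' | h'
  · exact (hne ((h.leaf h'.1).unique hw hx)).elim
  · exact h'.1

/-- The edges of a star packing form a total edge dominating set: every edge has a covered endpoint,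
and every star has at least two edges. -/
theorem isTEDSet (h : IsStarPacking G D A₁ A₂) : IsTEDSet G D.edgeSet := by
  have key : ∀ a b, G.Adj a b → (a ∈ A₁ ∨ a ∈ A₂) → ∃ f ∈ D.edgeSet, EdgeAdj s(a, b) f := by
    intro a b hab ha
    by_cases hD : D.Adj a b
    · obtain ⟨c, hc, x, hx, hne, hcab⟩ : ∃ c, c ∈ s(a, b) ∧ ∃ x, D.Adj c x ∧ s(a, b) ≠ s(c, x) ∧
          True := by
        rcases h.adj_cases hD with h' | h'
        · obtain ⟨w, w', hne, hw, hw'⟩ := h.centre h'.2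
          refine ⟨b, by simp, ?_⟩
          by_cases hwa : w = a
          · exact ⟨w', hw', fun e => hne (by grind), trivial⟩
          · exact ⟨w, hw, fun e => hwa (by grind), trivial⟩
        · obtain ⟨w, w', hne, hw, hw'⟩ := h.centre h'.1
          refine ⟨a, by simp, ?_⟩
          by_cases hwa : w = b
          · exact ⟨w', hw', fun e => hne (by grind), trivial⟩
          · exact ⟨w, hw, fun e => hwa (by grind), trivial⟩
      exact ⟨s(c, x), hx, hne, c, hc, by simp⟩
    · obtain ⟨x, hx⟩ := h.exists_adj ha
      refine ⟨s(a, x), hx, ?_, a, by simp, by simp⟩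
      intro e
      apply hD
      have : s(a, b) ∈ D.edgeSet := e ▸ hx
      exact this
  refine ⟨?_, ?_⟩
  · intro e
    induction e with | _ a b => exact fun hd => h.le hd
  · intro e
    induction e with
    | _ a b =>
      intro hab
      rcases h.cover hab with h' | h' | h' | h'
      · exact key a b hab (.inl h')
      · exact key a b hab (.inr h')
      · rw [Sym2.eq_swap]; exact key b a hab.symm (.inl h')
      · rw [Sym2.eq_swap]; exact key b a hab.symm (.inr h')

theorem encard_edgeSet_le (h : IsStarPacking G D A₁ A₂) : D.edgeSet.encard ≤ A₁.encard := by
  classical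
  choose! c hc using fun a (ha : a ∈ A₁) => (h.leaf ha).exists
  have : D.edgeSet ⊆ (fun a => s(a, c a)) '' A₁ := by
    intro e
    induction e with
    | _ a b =>
      intro hab
      have hab' : D.Adj a b := hab
      rcases h.adj_cases hab' with h' | h'
      · exact ⟨a, h'.1, by simp [(h.leaf h'.1).unique hab' (hc a h'.1)]⟩
      · refine ⟨b, h'.2, ?_⟩
        simp only
        rw [← (h.leaf h'.2).unique hab'.symm (hc b h'.2), Sym2.eq_swap]
  exact (Set.encard_le_encard this).trans (Set.encard_image_le _ _)

/-- An edge touches at most one of the edges joining a leaf of a star to a chosen private neighbour,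
so every edge dominating set has at least as many edges as the packing. -/
theorem encard_le_of_isEDSet (h : IsStarPacking G D A₁ A₂) {F : Set (Sym2 V)}
    (hF : IsEDSet G F) : A₁.encard ≤ F.encard := by
  choose! x hx₁ hx₂ hadj hu using fun w (hw : w ∈ A₁) => h.priv hw
  have hex : ∀ w ∈ A₁, ∃ f ∈ F, w ∈ f ∨ x w ∈ f := by
    intro w hw
    by_cases hf : s(w, x w) ∈ F
    · exact ⟨_, hf, by simp⟩
    · obtain ⟨f, hf, _, v, hv, hvf⟩ := hF.2 s(w, x w) (hadj w hw) hf
      refine ⟨f, hf, ?_⟩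
      rcases Sym2.mem_iff.1 hv with rfl | rfl <;> simp [hvf]
  rcases A₁.eq_empty_or_nonempty with rfl | ⟨v, _⟩
  · simp
  have : Nonempty (Sym2 V) := ⟨s(v, v)⟩
  choose! f hfF hf using hex
  refine Set.encard_le_encard_of_injOn (f := f) (fun w hw => hfF w hw) ?_
  intro w hw w' hw' he
  by_contra hne
  have hE : ∀ a b, a ∈ f w → b ∈ f w → a ≠ b → G.Adj a b := by
    intro a b ha hb hab
    have h1 : f w = s(a, b) := ((Sym2.mem_and_mem_iff hab).1 ⟨ha, hb⟩)
    have h2 := hF.1 (hfF w hw)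
    rw [h1] at h2
    exact h2
  have h1 := hf w hw
  have h2 := hf w' hw'
  rw [← he] at h2
  rcases h1 with h1 | h1 <;> rcases h2 with h2 | h2
  · exact h.indep hw hw' (hE _ _ h1 h2 hne)
  · refine hne (hu w' hw' w hw (hE _ _ h1 h2 ?_))
    intro e; exact hx₁ w' hw' (e ▸ hw)
  · refine hne (hu w hw w' hw' (hE _ _ h2 h1 ?_)).symm
    intro e; exact hx₁ w hw (e ▸ hw')
  · by_cases hxx : x w = x w'
    · exact hne (hu w' hw' w hw (hxx ▸ hadj w hw))
    · rcases h.cover (hE _ _ h1 h2 hxx) with h3 | h3 | h3 | h3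
      exacts [hx₁ w hw h3, hx₂ w hw h3, hx₁ w' hw' h3, hx₂ w' hw' h3]

end IsStarPacking

theorem IsTEDSet.isEDSet {V : Type u} {G : SimpleGraph V} {F : Set (Sym2 V)} (h : IsTEDSet G F) :
    IsEDSet G F := ⟨h.1, fun e he _ => h.2 e he⟩

theorem edgeDomNumber_le {V : Type u} {G : SimpleGraph V} {F : Set (Sym2 V)} (h : IsEDSet G F) :
    edgeDomNumber G ≤ F.encard :=
  iInf_le (fun F : {F : Set (Sym2 V) // IsEDSet G F} => F.1.encard) ⟨F, h⟩

theorem totalEdgeDomNumber_le {V : Type u} {G : SimpleGraph V} {F : Set (Sym2 V)}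
    (h : IsTEDSet G F) : totalEdgeDomNumber G ≤ F.encard :=
  iInf_le (fun F : {F : Set (Sym2 V) // IsTEDSet G F} => F.1.encard) ⟨F, h⟩

theorem edgeDomNumber_le_totalEdgeDomNumber {V : Type u} (G : SimpleGraph V) :
    edgeDomNumber G ≤ totalEdgeDomNumber G :=
  le_iInf fun F => edgeDomNumber_le F.2.isEDSet

namespace IsStarPacking

variable {V : Type u} {G D : SimpleGraph V} {A₁ A₂ : Set V}

theorem encard_le_edgeDomNumber (h : IsStarPacking G D A₁ A₂) :
    D.edgeSet.encard ≤ edgeDomNumber G :=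
  le_iInf fun F => h.encard_edgeSet_le.trans (h.encard_le_of_isEDSet F.2)

theorem totalEdgeDomNumber_eq (h : IsStarPacking G D A₁ A₂) :
    totalEdgeDomNumber G = edgeDomNumber G :=
  le_antisymm ((totalEdgeDomNumber_le h.isTEDSet).trans h.encard_le_edgeDomNumber)
    (edgeDomNumber_le_totalEdgeDomNumber G)

theorem isMinTEDSet (h : IsStarPacking G D A₁ A₂) : IsMinTEDSet G D.edgeSet :=
  ⟨h.isTEDSet, le_antisymm
    (h.encard_le_edgeDomNumber.trans (edgeDomNumber_le_totalEdgeDomNumber G))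
    (totalEdgeDomNumber_le h.isTEDSet)⟩

end IsStarPacking

/-! ### Paths and distances in trees -/

section Tree

variable {V : Type u} {G : SimpleGraph V}

theorem path_two_unique (hG : G.IsAcyclic) {a b b' c : V} (hac : a ≠ c) (h₁ : G.Adj a b)
    (h₂ : G.Adj b c) (h₁' : G.Adj a b') (h₂' : G.Adj b' c) : b = b' := by
  have h := (hG.subsingleton_path a c).allEq
    ⟨.cons h₁ (.cons h₂ .nil), by simp [h₁.ne, h₂.ne, hac]⟩
    ⟨.cons h₁' (.cons h₂' .nil), by simp [h₁'.ne, h₂'.ne, hac]⟩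
  have h' := congrArg (fun p : G.Path a c => p.1.support) h
  simpa using h'

theorem not_triangle (hG : G.IsAcyclic) {a b c : V} (h₁ : G.Adj a b) (h₂ : G.Adj b c)
    (h₃ : G.Adj a c) : False := by
  have h := (hG.subsingleton_path a c).allEq
    ⟨.cons h₁ (.cons h₂ .nil), by simp [h₁.ne, h₂.ne, h₃.ne]⟩ ⟨.cons h₃ .nil, by simp [h₃.ne]⟩
  have h' := congrArg (fun p : G.Path a c => p.1.length) h
  simp at h'

theorem path_three_unique (hG : G.IsAcyclic) {a b c d b' c' : V} (h₁ : G.Adj a b)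
    (h₂ : G.Adj b c) (h₃ : G.Adj c d) (h₁' : G.Adj a b') (h₂' : G.Adj b' c') (h₃' : G.Adj c' d)
    (had : a ≠ d) (hac : a ≠ c) (hbd : b ≠ d) (hac' : a ≠ c') (hbd' : b' ≠ d) : b = b' := by
  have h := (hG.subsingleton_path a d).allEq
    ⟨.cons h₁ (.cons h₂ (.cons h₃ .nil)), by simp [h₁.ne, h₂.ne, h₃.ne, hac, hbd, had]⟩
    ⟨.cons h₁' (.cons h₂' (.cons h₃' .nil)), by simp [h₁'.ne, h₂'.ne, h₃'.ne, hac', hbd', had]⟩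
  have h' := congrArg (fun p : G.Path a d => p.1.support) h
  simp at h'
  exact h'.1

theorem dist_eq_length_of_isPath (hG : G.IsTree) {a b : V} (p : G.Walk a b) (hp : p.IsPath) :
    G.dist a b = p.length := by
  obtain ⟨q, hq, hl⟩ := hG.connected.exists_path_of_dist a b
  rw [← hl, (hG.existsUnique_path a b).unique hq hp]

theorem parent_unique (hG : G.IsTree) {r x a b : V} (ha : G.Adj a x) (hb : G.Adj b x)
    (hda : G.dist r a < G.dist r x) (hdb : G.dist r b < G.dist r x) : a = b := by
  have key : ∀ a, G.Adj a x → G.dist r a < G.dist r x →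
      ∃ p : G.Walk r a, ∀ h : G.Adj a x, (p.concat h).IsPath := by
    intro a ha hda
    obtain ⟨p, hp⟩ := hG.connected.exists_walk_length_eq_dist r a
    refine ⟨p, fun h => SimpleGraph.Walk.isPath_of_length_eq_dist _ ?_⟩
    have := hG.dist_eq_dist_add_one_of_adj r ha
    rw [SimpleGraph.Walk.length_concat, hp]
    omega
  obtain ⟨p, hp⟩ := key a ha hda
  obtain ⟨q, hq⟩ := key b hb hdb
  have h := (hG.existsUnique_path r x).unique (hp ha) (hq hb)
  have h' := congrArg SimpleGraph.Walk.penultimate h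
  simpa using h'

theorem exists_parent (hG : G.IsTree) {r x : V} (hx : x ≠ r) :
    ∃ y, G.Adj x y ∧ G.dist r x = G.dist r y + 1 := by
  obtain ⟨p, hp⟩ := hG.connected.exists_walk_length_eq_dist x r
  cases p with
  | nil => exact (hx rfl).elim
  | @cons _ y _ h q =>
    refine ⟨y, h, ?_⟩
    have h1 := SimpleGraph.dist_le q
    have h2 := hG.dist_eq_dist_add_one_of_adj r h
    rw [SimpleGraph.Walk.length_cons] at hp
    rw [SimpleGraph.dist_comm] at hp h1
    rw [SimpleGraph.dist_comm (u := r) (v := y)] at *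
    rw [SimpleGraph.dist_comm (u := r) (v := x)] at *
    omega

end Tree

/-! ### Minimum total edge dominating sets of trees are star packings -/

section Replace

variable {V : Type u} {G : SimpleGraph V}

theorem isEDSet_of_cover {F : Set (Sym2 V)} (hF : F ⊆ G.edgeSet)
    (h : ∀ a b, G.Adj a b → ∃ f ∈ F, a ∈ f ∨ b ∈ f) : IsEDSet G F := by
  refine ⟨hF, fun e => ?_⟩
  induction e with
  | _ a b =>
    intro hab he
    obtain ⟨f, hf, hv⟩ := h a b hab
    refine ⟨f, hf, fun e => he (e ▸ hf), ?_⟩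
    rcases hv with hv | hv
    exacts [⟨a, by simp, hv⟩, ⟨b, by simp, hv⟩]

/-- Deleting an edge of a minimum edge dominating set and replacing each of the others by a single
edge never gives an edge dominating set. -/
theorem not_isEDSet_image {F : Set (Sym2 V)} (hfin : F.Finite)
    (hmin : F.encard = edgeDomNumber G) {e : Sym2 V} (he : e ∈ F) (φ : Sym2 V → Sym2 V) :
    ¬ IsEDSet G (φ '' (F \ {e})) := by
  intro h
  have h1 := (edgeDomNumber_le h).trans (Set.encard_image_le φ _)
  rw [← hmin] at h1
  have h2 : (F \ {e}).encard < F.encard :=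
    (hfin.subset Set.sdiff_subset).encard_lt_encard
      ⟨Set.sdiff_subset, fun hs => (hs he).2 rfl⟩
  exact absurd h1 (not_le.2 h2)

/-- In a total edge dominating set that has minimum size among edge dominating sets, every edge `e`
has an endpoint on no other edge of the set, because some edge outside the set is adjacent to no other
edge of it; the other endpoint of `e` lies on a second edge of the set. Thus the set consists of
disjoint stars with at least two edges each. -/
theorem exists_leaf_endpoint {F : Set (Sym2 V)} (hfin : F.Finite) (hT : IsTEDSet G F)
    (hmin : F.encard = edgeDomNumber G) {e : Sym2 V} (he : e ∈ F) :
    ∃ y x, e = s(x, y) ∧ (∀ f ∈ F, y ∈ f → f = e) ∧ ∃ f ∈ F, f ≠ e ∧ x ∈ f := by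
  have hne := not_isEDSet_image hfin hmin he id
  rw [Set.image_id] at hne
  have : ∃ f ∈ G.edgeSet, f ∉ F \ {e} ∧ ∀ g ∈ F \ {e}, ¬ EdgeAdj f g := by
    by_contra hcon
    push Not at hcon
    exact hne ⟨Set.sdiff_subset.trans hT.1, fun f hf hfF => hcon f hf hfF⟩
  obtain ⟨f, hf, hfF, hg⟩ := this
  have hfe : f ≠ e := by
    rintro rfl
    obtain ⟨g, hg1, hg2⟩ := hT.2 f hf
    exact hg g ⟨hg1, fun h => hg2.1 h.symm⟩ hg2
  have hfF' : f ∉ F := fun h => hfF ⟨h, hfe⟩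
  obtain ⟨g, hg1, hg2⟩ := hT.2 f hf
  have hge : g = e := by
    by_contra h
    exact hg g ⟨hg1, h⟩ hg2
  subst hge
  obtain ⟨-, y, hyf, hyg⟩ := hg2
  obtain ⟨x, rfl⟩ := Sym2.mem_iff_exists.1 hyg
  have hy : ∀ f' ∈ F, y ∈ f' → f' = s(y, x) := by
    intro f' hf' hy'
    by_contra h
    exact hg f' ⟨hf', h⟩ ⟨fun e => hfF' (e ▸ hf'), y, hyf, hy'⟩
  refine ⟨y, x, Sym2.eq_swap, hy, ?_⟩
  obtain ⟨k, hk1, hk2, v, hv, hvk⟩ := hT.2 _ (hT.1 he)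
  refine ⟨k, hk1, hk2.symm, ?_⟩
  rcases Sym2.mem_iff.1 hv with rfl | rfl
  · exact (hk2 (hy k hk1 hvk).symm).elim
  · exact hvk

open scoped Classical in
/-- Exchange at an edge `ww'` between leaves of stars with centres `c`, `c'`:
replacing `cw` and `c'w'` by `ww'` would give a smaller edge dominating set. -/
theorem not_adj_leaves (hG : G.IsAcyclic) {F : Set (Sym2 V)} (hfin : F.Finite)
    (hT : IsTEDSet G F) (hmin : F.encard = edgeDomNumber G) {c c' w w' : V}
    (hc : s(c, w) ∈ F) (hc' : s(c', w') ∈ F) (hw : ∀ f ∈ F, w ∈ f → f = s(c, w))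
    (hw' : ∀ f ∈ F, w' ∈ f → f = s(c', w')) (hcf : ∃ f ∈ F, f ≠ s(c, w) ∧ c ∈ f)
    (hcf' : ∃ f ∈ F, f ≠ s(c', w') ∧ c' ∈ f) : ¬ G.Adj w w' := by
  intro hadj
  have hcw : G.Adj c w := hT.1 hc
  have hcw' : G.Adj c' w' := hT.1 hc'
  have hcc : c ≠ c' := by
    rintro rfl
    exact not_triangle hG hcw hadj hcw'
  have hne : s(c, w) ≠ s(c', w') := by
    intro e
    have := hadj.ne
    grind
  set φ : Sym2 V → Sym2 V := fun e => if e = s(c, w) then s(w, w') else e with hφ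
  apply not_isEDSet_image hfin hmin hc' φ
  have hmem : s(w, w') ∈ φ '' (F \ {s(c', w')}) := ⟨s(c, w), ⟨hc, hne⟩, by simp [hφ]⟩
  have hkeep : ∀ f ∈ F, f ≠ s(c, w) → f ≠ s(c', w') → f ∈ φ '' (F \ {s(c', w')}) :=
    fun f hf h1 h2 => ⟨f, ⟨hf, h2⟩, by simp [hφ, h1]⟩
  have hcov : ∀ v, (∃ f ∈ F, v ∈ f) → ∃ f ∈ φ '' (F \ {s(c', w')}), v ∈ f := by
    rintro v ⟨f, hf, hv⟩
    by_cases hvw : v = w ∨ v = w'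
    · exact ⟨_, hmem, by simpa using hvw⟩
    push Not at hvw
    by_cases h1 : f = s(c, w)
    · subst h1
      have hvc : v = c := by simpa [hvw.1] using hv
      subst hvc
      obtain ⟨g, hg, hg1, hg2⟩ := hcf
      refine ⟨g, hkeep g hg hg1 ?_, hg2⟩
      rintro rfl
      simp [hcc, hvw.2] at hg2
    by_cases h2 : f = s(c', w')
    · subst h2
      have hvc : v = c' := by simpa [hvw.2] using hv
      subst hvc
      obtain ⟨g, hg, hg1, hg2⟩ := hcf'
      refine ⟨g, hkeep g hg ?_ hg1, hg2⟩
      rintro rfl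
      simp [hcc.symm, hvw.1] at hg2
    exact ⟨f, hkeep f hf h1 h2, hv⟩
  refine isEDSet_of_cover ?_ ?_
  · rintro _ ⟨f, hf, rfl⟩
    by_cases h1 : f = s(c, w)
    · simpa [hφ, h1] using hadj
    · simpa [hφ, h1] using hT.1 hf.1
  · intro a b hab
    obtain ⟨f, hf, _, v, hv, hvf⟩ := hT.2 s(a, b) hab
    rcases Sym2.mem_iff.1 hv with rfl | rfl
    · obtain ⟨g, hg, h⟩ := hcov v ⟨f, hf, hvf⟩
      exact ⟨g, hg, .inl h⟩
    · obtain ⟨g, hg, h⟩ := hcov v ⟨f, hf, hvf⟩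
      exact ⟨g, hg, .inr h⟩

/-- If every uncovered neighbour `x` of a leaf `w` had a second neighbour `y` among the leaves, then
deleting the edge at `w` and replacing the star edge at each such `y` by `xy` would give a smaller
edge dominating set. Acyclicity guarantees that every star keeps an edge. -/
theorem exists_private (hG : G.IsAcyclic) {D : SimpleGraph V} {A₁ A₂ : Set V} (hle : D ≤ G)
    (hfin : D.edgeSet.Finite) (hmin : D.edgeSet.encard = edgeDomNumber G)
    (hcases : ∀ {a b}, D.Adj a b → (a ∈ A₁ ∧ b ∈ A₂) ∨ (a ∈ A₂ ∧ b ∈ A₁))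
    (hleaf : ∀ {a}, a ∈ A₁ → ∃! c, D.Adj a c)
    (hcentre : ∀ {c}, c ∈ A₂ → ∃ w w', w ≠ w' ∧ D.Adj c w ∧ D.Adj c w')
    (hcover : ∀ {a b}, G.Adj a b → a ∈ A₁ ∨ a ∈ A₂ ∨ b ∈ A₁ ∨ b ∈ A₂)
    (hindep : ∀ {a b}, a ∈ A₁ → b ∈ A₁ → ¬ G.Adj a b) {w : V} (hw : w ∈ A₁) :
    ∃ x, x ∉ A₁ ∧ x ∉ A₂ ∧ G.Adj w x ∧ ∀ w' ∈ A₁, G.Adj w' x → w' = w := by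
  by_contra hcon
  push Not at hcon
  have hdisj : ∀ {v}, v ∈ A₁ → v ∈ A₂ → False := by
    intro v h1 h2
    obtain ⟨a, b, hne, ha, hb⟩ := hcentre h2
    exact hne ((hleaf h1).unique ha hb)
  have hc2 : ∀ {a b}, a ∈ A₁ → D.Adj a b → b ∈ A₂ := by
    intro a b ha hab
    rcases hcases hab with h | h
    exacts [h.2, (hdisj ha h.1).elim]
  have hc1 : ∀ {a b}, a ∈ A₂ → D.Adj a b → b ∈ A₁ := by
    intro a b ha hab
    rcases hcases hab with h | h
    exacts [(hdisj h.1 ha).elim, h.2]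
  obtain ⟨c, hwc, -⟩ := hleaf hw
  let R : V → V → Prop := fun y x => y ∈ A₁ ∧ y ≠ w ∧ x ∉ A₁ ∧ x ∉ A₂ ∧ G.Adj w x ∧ G.Adj y x
  have hR : ∀ {y x x'}, R y x → R y x' → x = x' := fun h h' =>
    path_two_unique hG h.2.1.symm h.2.2.2.2.1 h.2.2.2.2.2.symm h'.2.2.2.2.1 h'.2.2.2.2.2.symm
  have hex : ∀ e : Sym2 V, ∃ e' : Sym2 V, (∃ y x, R y x ∧ y ∈ e ∧ e' = s(y, x)) ∨
      ((¬ ∃ y x, R y x ∧ y ∈ e) ∧ e' = e) := by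
    intro e
    by_cases h : ∃ y x, R y x ∧ y ∈ e
    · obtain ⟨y, x, h, hy⟩ := h
      exact ⟨_, .inl ⟨y, x, h, hy, rfl⟩⟩
    · exact ⟨e, .inr ⟨h, rfl⟩⟩
  choose φ hφ using hex
  have hmem : s(w, c) ∈ D.edgeSet := hwc
  apply not_isEDSet_image hfin hmin hmem φ
  have hy : ∀ y ∈ A₁, y ≠ w → ∃ c', D.Adj y c' ∧ c' ∈ A₂ ∧
      s(y, c') ∈ D.edgeSet \ {s(w, c)} := by
    intro y hy hyw
    obtain ⟨c', hc', -⟩ := hleaf hy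
    refine ⟨c', hc', hc2 hy hc', hc', fun e => ?_⟩
    rcases Sym2.eq_iff.1 (show s(y, c') = s(w, c) from e) with h | h
    · exact hyw h.1
    · exact hdisj hw (h.2 ▸ hc2 hy hc')
  -- the leaves other than `w` stay covered
  have cov1 : ∀ y ∈ A₁, y ≠ w → ∃ f ∈ φ '' (D.edgeSet \ {s(w, c)}), y ∈ f := by
    intro y hyA hyw
    obtain ⟨c', hc', hcA, hm⟩ := hy y hyA hyw
    refine ⟨_, ⟨_, hm, rfl⟩, ?_⟩
    rcases hφ s(y, c') with ⟨y', x, hR', hy', he⟩ | ⟨-, he⟩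
    · rcases Sym2.mem_iff.1 hy' with rfl | rfl
      · rw [he]; simp
      · exact (hdisj hR'.1 hcA).elim
    · rw [he]; simp
  -- the uncovered neighbours of `w` become covered
  have cov0 : ∀ x, x ∉ A₁ → x ∉ A₂ → G.Adj w x →
      ∃ f ∈ φ '' (D.edgeSet \ {s(w, c)}), x ∈ f := by
    intro x hx1 hx2 hwx
    obtain ⟨y, hyA, hyx, hyw⟩ := hcon x hx1 hx2 hwx
    obtain ⟨c', hc', hcA, hm⟩ := hy y hyA hyw
    have hRy : R y x := ⟨hyA, hyw, hx1, hx2, hwx, hyx⟩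
    refine ⟨_, ⟨_, hm, rfl⟩, ?_⟩
    rcases hφ s(y, c') with ⟨y', x', hR', hy', he⟩ | ⟨hn, -⟩
    · rcases Sym2.mem_iff.1 hy' with rfl | rfl
      · rw [he, hR hRy hR']; simp
      · exact (hdisj hR'.1 hcA).elim
    · exact (hn ⟨y, x, hRy, by simp⟩).elim
  -- the centres stay covered, since no star loses two edges
  have cov2 : ∀ c' ∈ A₂, ∃ f ∈ φ '' (D.edgeSet \ {s(w, c)}), c' ∈ f := by
    intro c' hc'
    obtain ⟨y₁, y₂, hne, h₁, h₂⟩ := hcentre hc'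
    have key : ∀ y, D.Adj c' y → y ≠ w → (¬ ∃ x, R y x) →
        ∃ f ∈ φ '' (D.edgeSet \ {s(w, c)}), c' ∈ f := by
      intro y hcy hyw hn
      obtain ⟨c'', hc'', -, hm⟩ := hy y (hc1 hc' hcy) hyw
      obtain rfl := (hleaf (hc1 hc' hcy)).unique hcy.symm hc''
      refine ⟨_, ⟨_, hm, rfl⟩, ?_⟩
      rcases hφ s(y, c') with ⟨y', x', hR', hy', he⟩ | ⟨-, he⟩
      · rcases Sym2.mem_iff.1 hy' with rfl | rfl
        · exact (hn ⟨x', hR'⟩).elim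
        · exact (hdisj hR'.1 hc').elim
      · rw [he]; simp
    have key' : ∀ y, D.Adj c' w → D.Adj c' y → y ≠ w → ¬ ∃ x, R y x := by
      rintro y h1 h2 hyw ⟨x, hx⟩
      have := path_two_unique hG hyw.symm (hle h1).symm (hle h2) hx.2.2.2.2.1 hx.2.2.2.2.2.symm
      exact hx.2.2.2.1 (this ▸ hc')
    by_cases h1 : y₁ = w
    · subst h1
      exact key y₂ h₂ hne.symm (key' y₂ h₁ h₂ hne.symm)
    by_cases h2 : y₂ = w
    · subst h2
      exact key y₁ h₁ h1 (key' y₁ h₂ h₁ h1)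
    by_cases h3 : ∃ x, R y₁ x
    swap
    · exact key y₁ h₁ h1 h3
    by_cases h4 : ∃ x, R y₂ x
    swap
    · exact key y₂ h₂ h2 h4
    exfalso
    obtain ⟨x₁, hx₁⟩ := h3
    obtain ⟨x₂, hx₂⟩ := h4
    have hxc : ∀ {y x}, R y x → x ≠ c' := fun h e => h.2.2.2.1 (e ▸ hc')
    have h5 : x₁ = x₂ := path_three_unique hG hx₁.2.2.2.2.1 hx₁.2.2.2.2.2.symm (hle h₁).symm
      hx₂.2.2.2.2.1 hx₂.2.2.2.2.2.symm (hle h₂).symm (fun e => hdisj hw (e ▸ hc'))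
      hx₁.2.1.symm (hxc hx₁) hx₂.2.1.symm (hxc hx₂)
    subst h5
    exact hxc hx₁ (path_two_unique hG hne hx₁.2.2.2.2.2 hx₂.2.2.2.2.2.symm (hle h₁).symm (hle h₂))
  have cov : ∀ a b, G.Adj a b → (a ∈ A₁ ∨ a ∈ A₂) →
      ∃ f ∈ φ '' (D.edgeSet \ {s(w, c)}), a ∈ f ∨ b ∈ f := by
    intro a b hab ha
    rcases ha with ha | ha
    · by_cases haw : a = w
      · subst haw
        by_cases hb : b ∈ A₂
        · obtain ⟨f, hf, h⟩ := cov2 b hb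
          exact ⟨f, hf, .inr h⟩
        · obtain ⟨f, hf, h⟩ := cov0 b (fun h => hindep ha h hab) hb hab
          exact ⟨f, hf, .inr h⟩
      · obtain ⟨f, hf, h⟩ := cov1 a ha haw
        exact ⟨f, hf, .inl h⟩
    · obtain ⟨f, hf, h⟩ := cov2 a ha
      exact ⟨f, hf, .inl h⟩
  refine isEDSet_of_cover ?_ ?_
  · rintro _ ⟨e, he, rfl⟩
    rcases hφ e with ⟨y, x, hR', -, he'⟩ | ⟨-, he'⟩
    · rw [he']; exact hR'.2.2.2.2.2
    · rw [he']; exact SimpleGraph.edgeSet_mono hle he.1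
  · intro a b hab
    rcases hcover hab with h | h | h | h
    · exact cov a b hab (.inl h)
    · exact cov a b hab (.inr h)
    · obtain ⟨f, hf, h⟩ := cov b a hab.symm (.inl h)
      exact ⟨f, hf, h.symm⟩
    · obtain ⟨f, hf, h⟩ := cov b a hab.symm (.inr h)
      exact ⟨f, hf, h.symm⟩

/-- A forest with `γ' = γ'_t` has a star packing: any minimum total edge dominating set is one. -/
theorem exists_isStarPacking [Finite V] (hG : G.IsAcyclic)
    (heq : totalEdgeDomNumber G = edgeDomNumber G) :
    ∃ D A₁ A₂, IsStarPacking G D A₁ A₂ := by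
  have hED : IsEDSet G G.edgeSet := ⟨subset_rfl, fun e he hn => (hn he).elim⟩
  have hlt : totalEdgeDomNumber G < ⊤ := heq ▸ (edgeDomNumber_le hED).trans_lt
    (Set.toFinite G.edgeSet).encard_lt_top
  have hne : Nonempty {F : Set (Sym2 V) // IsTEDSet G F} := by
    by_contra h
    rw [not_nonempty_iff] at h
    simp [totalEdgeDomNumber] at hlt
  obtain ⟨⟨F, hT⟩, hF⟩ := ENat.exists_eq_iInf fun F : {F : Set (Sym2 V) // IsTEDSet G F} => F.1.encard
  have hmin : F.encard = edgeDomNumber G := by rw [← heq]; exact hF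
  have hfin : F.Finite := Set.toFinite F
  set D := SimpleGraph.fromEdgeSet F with hD
  have hadj : ∀ {a b}, D.Adj a b ↔ s(a, b) ∈ F := by
    intro a b
    rw [hD, SimpleGraph.fromEdgeSet_adj]
    refine ⟨fun h => h.1, fun h => ⟨h, ?_⟩⟩
    exact (show G.Adj a b from hT.1 h).ne
  have hDF : D.edgeSet = F := by
    ext e
    induction e with | _ a b => exact hadj
  have hle : D ≤ G := fun a b h => hT.1 (hadj.1 h)
  set A₁ : Set V := {v | ∃! w, D.Adj v w} with hA₁
  set A₂ : Set V := {v | ∃ w w', w ≠ w' ∧ D.Adj v w ∧ D.Adj v w'} with hA₂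
  have hends : ∀ {a b}, D.Adj a b → ∃ y x, s(a, b) = s(x, y) ∧
      (∀ f ∈ F, y ∈ f → f = s(x, y)) ∧ ∃ f ∈ F, f ≠ s(x, y) ∧ x ∈ f := by
    intro a b h
    obtain ⟨y, x, he, h1, h2⟩ := exists_leaf_endpoint hfin hT hmin (hadj.1 h)
    exact ⟨y, x, he, he ▸ h1, he ▸ h2⟩
  have hcls : ∀ {x y}, s(x, y) ∈ F → (∀ f ∈ F, y ∈ f → f = s(x, y)) →
      (∃ f ∈ F, f ≠ s(x, y) ∧ x ∈ f) → y ∈ A₁ ∧ x ∈ A₂ := by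
    rintro x y h h1 ⟨f, hf, hne, hx⟩
    constructor
    · refine ⟨x, hadj.2 (Sym2.eq_swap ▸ h), fun z hz => ?_⟩
      have := h1 _ (hadj.1 hz) (by simp)
      rw [Sym2.eq_swap] at this
      rcases (by simpa using this : z = x ∨ z = y ∧ y = x) with h | h
      exacts [h, h.1.trans h.2]
    · obtain ⟨z, rfl⟩ := Sym2.mem_iff_exists.1 hx
      exact ⟨y, z, fun e => hne (by rw [e]), hadj.2 h, hadj.2 hf⟩
  have hcases : ∀ {a b}, D.Adj a b → (a ∈ A₁ ∧ b ∈ A₂) ∨ (a ∈ A₂ ∧ b ∈ A₁) := by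
    intro a b h
    obtain ⟨y, x, he, h1, h2⟩ := hends h
    have := hcls (he ▸ hadj.1 h) h1 h2
    rcases Sym2.eq_iff.1 he with ⟨rfl, rfl⟩ | ⟨rfl, rfl⟩
    exacts [.inr this.symm, .inl this]
  have hleaf : ∀ {a}, a ∈ A₁ → ∃! c, D.Adj a c := fun h => h
  have hcentre : ∀ {c}, c ∈ A₂ → ∃ w w', w ≠ w' ∧ D.Adj c w ∧ D.Adj c w' := fun h => h
  have hcover : ∀ {a b}, G.Adj a b → a ∈ A₁ ∨ a ∈ A₂ ∨ b ∈ A₁ ∨ b ∈ A₂ := by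
    intro a b hab
    obtain ⟨f, hf, _, v, hv, hvf⟩ := hT.2 s(a, b) hab
    obtain ⟨z, rfl⟩ := Sym2.mem_iff_exists.1 hvf
    have := hcases (hadj.2 hf)
    rcases Sym2.mem_iff.1 hv with rfl | rfl <;> tauto
  have hindep : ∀ {a b}, a ∈ A₁ → b ∈ A₁ → ¬ G.Adj a b := by
    have key : ∀ {a}, a ∈ A₁ → ∃ c, s(c, a) ∈ F ∧ (∀ f ∈ F, a ∈ f → f = s(c, a)) ∧
        ∃ f ∈ F, f ≠ s(c, a) ∧ c ∈ f := by
      intro a ha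
      obtain ⟨c, hc, hu⟩ := ha
      have hca : s(c, a) ∈ F := Sym2.eq_swap ▸ hadj.1 hc
      obtain ⟨y, x, he, h1, h2⟩ := hends hc.symm
      rcases Sym2.eq_iff.1 he with ⟨rfl, rfl⟩ | ⟨rfl, rfl⟩
      · exact ⟨c, hca, h1, h2⟩
      · obtain ⟨f, hf, hfne, hx⟩ := h2
        obtain ⟨z, rfl⟩ := Sym2.mem_iff_exists.1 hx
        exact (hfne (by rw [hu z (hadj.2 hf)])).elim
    intro a b ha hb
    obtain ⟨c, h1, h2, h3⟩ := key ha
    obtain ⟨c', h1', h2', h3'⟩ := key hb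
    exact not_adj_leaves hG hfin hT hmin h1 h1' h2 h2' h3 h3'
  exact ⟨D, A₁, A₂, fun h => hle h, hcases, hleaf, hcentre, hcover, hindep,
    fun hw => exists_private hG hle (hDF ▸ hfin) (hDF ▸ hmin) hcases hleaf hcentre hcover hindep hw⟩

end Replace

/-! ### Labelled star packings and the operations -/

instance : DecidableEq EdgeLabel := fun a b => by
  cases a <;> cases b <;> first | exact isTrue rfl | exact isFalse (by simp)

/-- The graph of all `S`-edges of an edge-labelled graph. -/
def LGraph.sGraph {V : Type u} (T : LGraph V) : SimpleGraph V where
  Adj a b := T.lab a b = some S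
  symm := ⟨fun a b h => by rw [T.symm b a]; exact h⟩
  loopless := ⟨fun a h => by simp [T.irrefl a] at h⟩

theorem LGraph.adj_iff {V : Type u} {T : LGraph V} {a b : V} :
    T.graph.Adj a b ↔ T.lab a b ≠ none := Iff.rfl

theorem LGraph.sGraph_adj {V : Type u} {T : LGraph V} {a b : V} :
    T.sGraph.Adj a b ↔ T.lab a b = some S := Iff.rfl

theorem LGraph.sEdges_eq {V : Type u} (T : LGraph V) : T.sEdges = T.sGraph.edgeSet := by
  ext e
  induction e with
  | _ a b =>
    constructor
    · rintro ⟨x, y, he, h⟩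
      rw [he]
      exact h
    · intro h
      exact ⟨a, b, rfl, h⟩

/-- The `S`-edges of `T` form a star packing, and every edge at an uncovered vertex is labelled `L₁`
or `L₂` according to whether its other end is a leaf or a centre. -/
structure IsLabelledPacking {V : Type u} (T : LGraph V) (A₁ A₂ : Set V) : Prop extends
    IsStarPacking T.graph T.sGraph A₁ A₂ where
  lab₁ : ∀ {a x}, a ∈ A₁ → x ∉ A₁ → x ∉ A₂ → T.graph.Adj a x → T.lab a x = some L1
  lab₂ : ∀ {a x}, a ∈ A₂ → x ∉ A₁ → x ∉ A₂ → T.graph.Adj a x → T.lab a x = some L2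

namespace IsLabelledPacking

variable {V : Type u} {T : LGraph V} {A₁ A₂ : Set V}

theorem classA1_eq (h : IsLabelledPacking T A₁ A₂) : T.classA1 = A₁ :=
  Set.ext fun _ => h.mem_left_iff.symm

theorem classA2_eq (h : IsLabelledPacking T A₁ A₂) : T.classA2 = A₂ :=
  Set.ext fun _ => h.mem_right_iff.symm

theorem congr_classes (h : IsLabelledPacking T A₁ A₂) :
    IsLabelledPacking T T.classA1 T.classA2 := by
  rw [h.classA1_eq, h.classA2_eq]; exact h

theorem uncovered_of_mem_classB (h : IsLabelledPacking T A₁ A₂) {v : V} (hv : v ∈ T.classB) :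
    v ∉ A₁ ∧ v ∉ A₂ ∧ ∀ w ∈ A₁, ¬ T.graph.Adj w v := by
  have h0 : ¬ (v ∈ A₁ ∨ v ∈ A₂) := by
    intro h'
    obtain ⟨w, hw⟩ := h.exists_adj h'
    have := hv w (h.le hw)
    rw [sGraph_adj.1 hw] at this
    simp at this
  push Not at h0
  refine ⟨h0.1, h0.2, fun w hw hadj => ?_⟩
  have h1 := h.lab₁ hw h0.1 h0.2 hadj
  rw [T.symm, hv w hadj.symm] at h1
  simp at h1

theorem mem_classB_of (h : IsLabelledPacking T A₁ A₂) {v : V} (h₁ : v ∉ A₁) (h₂ : v ∉ A₂)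
    (hv : ∀ w ∈ A₁, ¬ T.graph.Adj w v) : v ∈ T.classB := by
  intro w hw
  rw [T.symm]
  refine h.lab₂ ?_ h₁ h₂ hw.symm
  rcases h.cover hw with h' | h' | h' | h'
  exacts [(h₁ h').elim, (h₂ h').elim, (hv w h' hw.symm).elim, h']

theorem of_equiv {W : Type u} {T' : LGraph W} (h : IsLabelledPacking T A₁ A₂) (e : V ≃ W)
    (he : ∀ a b, T'.lab (e a) (e b) = T.lab a b) :
    IsLabelledPacking T' {w | e.symm w ∈ A₁} {w | e.symm w ∈ A₂} := by
  have hl : ∀ a b, T'.lab a b = T.lab (e.symm a) (e.symm b) := fun a b => by simp [← he]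
  have hg : ∀ a b, T'.graph.Adj a b ↔ T.graph.Adj (e.symm a) (e.symm b) := fun a b => by
    simp only [adj_iff, hl]
  have hs : ∀ a b, T'.sGraph.Adj a b ↔ T.sGraph.Adj (e.symm a) (e.symm b) := fun a b => by
    simp only [sGraph_adj, hl]
  refine ⟨⟨?_, ?_, ?_, ?_, ?_, ?_, ?_⟩, ?_, ?_⟩
  · intro a b hab
    rw [hs] at hab
    rw [hg]
    exact h.le hab
  · intro a b hab
    rw [hs] at hab
    exact h.adj_cases hab
  · intro a ha
    obtain ⟨c, hc, hu⟩ := h.leaf ha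
    refine ⟨e c, (hs _ _).2 (by simpa using hc), fun y hy => ?_⟩
    rw [← hu _ ((hs _ _).1 hy)]; simp
  · intro a ha
    obtain ⟨c, c', hne, hc, hc'⟩ := h.centre ha
    exact ⟨e c, e c', by simpa using hne, (hs _ _).2 (by simpa using hc),
      (hs _ _).2 (by simpa using hc')⟩
  · intro a b hab
    exact h.cover ((hg _ _).1 hab)
  · intro a b ha hb hab
    exact h.indep ha hb ((hg _ _).1 hab)
  · intro w hw
    obtain ⟨x, h1, h2, h3, h4⟩ := h.priv hw
    refine ⟨e x, by simpa using h1, by simpa using h2, (hg _ _).2 (by simpa using h3), ?_⟩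
    intro w' hw' hadj
    have := h4 _ hw' (by simpa using (hg _ _).1 hadj)
    simpa using this
  · intro a x h1 h2 h3 h4
    rw [hl]
    exact h.lab₁ h1 h2 h3 ((hg _ _).1 h4)
  · intro a x h1 h2 h3 h4
    rw [hl]
    exact h.lab₂ h1 h2 h3 ((hg _ _).1 h4)

/-- The side condition of the third operation gives every leaf a private neighbour other
than `v`. -/
theorem exists_private_ne (h : IsLabelledPacking T A₁ A₂) {v : V}
    (hC : v ∈ T.classC → T.O3Condition v) {w : V} (hw : w ∈ A₁) :
    ∃ x, x ≠ v ∧ x ∉ A₁ ∧ x ∉ A₂ ∧ T.graph.Adj w x ∧ ∀ w' ∈ A₁, T.graph.Adj w' x → w' = w := by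
  by_cases hv : v ∈ A₁ ∨ v ∈ A₂
  · obtain ⟨x, h1, h2, h3⟩ := h.priv hw
    exact ⟨x, by rintro rfl; tauto, h1, h2, h3⟩
  push Not at hv
  by_cases hvw : T.graph.Adj w v
  swap
  · obtain ⟨x, h1, h2, h3⟩ := h.priv hw
    exact ⟨x, by rintro rfl; exact hvw h3.1, h1, h2, h3⟩
  have hlab := h.lab₁ hw hv.1 hv.2 hvw
  have hvC : v ∈ T.classC := by
    rw [classC, h.classA1_eq, h.classA2_eq]
    rintro ((h' | h') | h')
    · exact hv.1 h'
    · exact hv.2 h'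
    · exact (h.uncovered_of_mem_classB h').2.2 w hw hvw
  have hleafcov : ∀ {z y}, T.graph.Adj z y → IsLeaf T.graph z → (z ∈ A₁ ∨ z ∈ A₂) →
      z ∈ A₁ ∧ y ∈ A₂ := by
    rintro z y hzy hz (h' | h')
    · obtain ⟨c, hc⟩ := h.exists_adj (.inl h')
      obtain rfl := hz.unique hzy (h.le hc)
      exact ⟨h', h.mem_right_of_mem_left h' hc⟩
    · obtain ⟨a, b, hne, ha, hb⟩ := h.centre h'
      exact (hne (hz.unique (h.le ha) (h.le hb))).elim
  rcases hC hvC w (by rw [T.symm]; exact hlab) with ⟨f, ⟨hf, l, hlf, hl⟩, hne, y, hy, hyf⟩ |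
    ⟨x, y, hnd, hwx, hxy, hall⟩
  · obtain ⟨z, rfl⟩ := Sym2.mem_iff_exists.1 hyf
    rcases Sym2.mem_iff.1 hy with rfl | rfl
    -- a leaf edge at `v` itself is impossible
    · exfalso
      have hvz : T.graph.Adj y z := hf
      have hzw : z ≠ w := by rintro rfl; exact hne rfl
      rcases Sym2.mem_iff.1 hlf with rfl | rfl
      · exact hzw (hl.unique hvz hvw.symm)
      · have hcov : l ∈ A₁ ∨ l ∈ A₂ := by
          rcases h.cover hvz with h' | h' | h' | h' <;> tauto
        exact hv.2 (hleafcov hvz.symm hl hcov).2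
    · have hwz : T.graph.Adj y z := hf
      have hzv : z ≠ v := by rintro rfl; exact hne Sym2.eq_swap
      rcases Sym2.mem_iff.1 hlf with rfl | rfl
      · exact (hzv (hl.unique hwz hvw)).elim
      · have hcov : ¬ (l ∈ A₁ ∨ l ∈ A₂) := fun h' =>
          h.not_mem_both hw (hleafcov hwz.symm hl h').2
        push Not at hcov
        exact ⟨l, hzv, hcov.1, hcov.2, hwz, fun w' _ h' => hl.unique h'.symm hwz.symm⟩
  · have hx : ¬ (x ∈ A₁ ∨ x ∈ A₂) := by
      intro h'
      obtain ⟨c, hc⟩ := h.exists_adj h'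
      have hc' := sGraph_adj.1 hc
      by_cases hcw : c = w
      · subst hcw
        rw [T.symm, hwx] at hc'
        simp at hc'
      · rw [hall c (h.le hc) hcw] at hc'
        simp at hc'
    push Not at hx
    refine ⟨x, ?_, hx.1, hx.2, by rw [adj_iff, hwx]; simp, ?_⟩
    · rintro rfl; simp at hnd
    · intro w' hw' hadj
      by_contra hcon
      have h1 := h.lab₁ hw' hx.1 hx.2 hadj
      rw [T.symm, hall w' hadj.symm hcon] at h1
      simp at h1

end IsLabelledPacking

/-- The requirements on a labelled graph `P` with prescribed leaves `Q₁` and centres `Q₂` for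
attaching it at its vertex `p`: it is a labelled packing, except that `p` may lack a private
neighbour, and `p` is covered unless there are no leaves at all. -/
structure IsAttachable {W : Type} (P : LGraph W) (p : W) (Q₁ Q₂ : Finset W) : Prop where
  adj_cases : ∀ a b, P.lab a b = some S → (a ∈ Q₁ ∧ b ∈ Q₂) ∨ (a ∈ Q₂ ∧ b ∈ Q₁)
  leaf : ∀ a ∈ Q₁, ∃ c, P.lab a c = some S ∧ ∀ c', P.lab a c' = some S → c' = c
  centre : ∀ c ∈ Q₂, ∃ w w', w ≠ w' ∧ P.lab c w = some S ∧ P.lab c w' = some S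
  cover : ∀ a b, P.lab a b ≠ none → a ∈ Q₁ ∨ a ∈ Q₂ ∨ b ∈ Q₁ ∨ b ∈ Q₂
  indep : ∀ a ∈ Q₁, ∀ b ∈ Q₁, P.lab a b = none
  priv : ∀ w ∈ Q₁, w ≠ p → ∃ x, x ∉ Q₁ ∧ x ∉ Q₂ ∧ P.lab w x ≠ none ∧
    ∀ w' ∈ Q₁, P.lab w' x ≠ none → w' = w
  lab₁ : ∀ a ∈ Q₁, ∀ x, x ∉ Q₁ → x ∉ Q₂ → P.lab a x = none ∨ P.lab a x = some L1
  lab₂ : ∀ a ∈ Q₂, ∀ x, x ∉ Q₁ → x ∉ Q₂ → P.lab a x = none ∨ P.lab a x = some L2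
  covered : ∀ w ∈ Q₁, p ∈ Q₁ ∨ p ∈ Q₂

section Join

variable {V : Type u} {T : LGraph V} {A₁ A₂ : Set V} {W : Type} {P : LGraph W} {v : V} {p : W}
  {Q₁ Q₂ : Finset W} {ℓ : EdgeLabel}

theorem join_lab_ll {a b : V} : (T.join v P p ℓ).lab (.inl a) (.inl b) = T.lab a b := rfl

theorem join_lab_rr {a b : W} : (T.join v P p ℓ).lab (.inr a) (.inr b) = P.lab a b := rfl

open scoped Classical in
theorem join_lab_lr {a : V} {b : W} : (T.join v P p ℓ).lab (.inl a) (.inr b) =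
    if a = v ∧ b = p then some ℓ else none := rfl

open scoped Classical in
theorem join_lab_rl {a : V} {b : W} : (T.join v P p ℓ).lab (.inr b) (.inl a) =
    if a = v ∧ b = p then some ℓ else none := rfl

/-- Joining an attachable graph by an edge not labelled `S` keeps the labelled packing. -/
theorem IsLabelledPacking.join (h : IsLabelledPacking T A₁ A₂) (hP : IsAttachable P p Q₁ Q₂)
    (hℓ : ℓ ≠ S) (hcov : v ∈ A₁ ∨ v ∈ A₂ ∨ p ∈ Q₁ ∨ p ∈ Q₂) (hind : p ∈ Q₁ → v ∉ A₁)
    (hpriv : p ∈ Q₁ → ∀ w ∈ A₁, ∃ x, x ≠ v ∧ x ∉ A₁ ∧ x ∉ A₂ ∧ T.graph.Adj w x ∧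
      ∀ w' ∈ A₁, T.graph.Adj w' x → w' = w)
    (hprivp : p ∈ Q₁ → (∃ x, x ∉ Q₁ ∧ x ∉ Q₂ ∧ P.lab p x ≠ none ∧
      ∀ w' ∈ Q₁, P.lab w' x ≠ none → w' = p) ∨
        (v ∉ A₁ ∧ v ∉ A₂ ∧ ∀ w ∈ A₁, ¬ T.graph.Adj w v))
    (hl₁ : v ∈ A₁ → p ∉ Q₁ → p ∉ Q₂ → ℓ = L1) (hl₂ : v ∈ A₂ → p ∉ Q₁ → p ∉ Q₂ → ℓ = L2)
    (hl₃ : p ∈ Q₁ → v ∉ A₁ → v ∉ A₂ → ℓ = L1) (hl₄ : p ∈ Q₂ → v ∉ A₁ → v ∉ A₂ → ℓ = L2) :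
    IsLabelledPacking (T.join v P p ℓ) {z | Sum.elim (· ∈ A₁) (· ∈ Q₁) z}
      {z | Sum.elim (· ∈ A₂) (· ∈ Q₂) z} := by
  have e0 : ∀ (a : V) (b : W), (T.join v P p ℓ).lab (.inl a) (.inr b) ≠ some S := by
    intro a b; rw [join_lab_lr]; split_ifs <;> simp [hℓ]
  refine ⟨⟨?_, ?_, ?_, ?_, ?_, ?_, ?_⟩, ?_, ?_⟩
  · intro a b hab
    rw [adj_iff, sGraph_adj.1 hab]
    simp
  · rintro (a | a) (b | b) hab <;> rw [sGraph_adj] at hab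
    · exact h.adj_cases hab
    · exact (e0 a b hab).elim
    · exact (e0 b a hab).elim
    · exact hP.adj_cases a b hab
  · rintro (a | a) ha
    · obtain ⟨c, hc, hu⟩ := h.leaf ha
      refine ⟨.inl c, hc, ?_⟩
      rintro (y | y) hy
      · exact congrArg _ (hu y hy)
      · exact (e0 a y hy).elim
    · obtain ⟨c, hc, hu⟩ := hP.leaf a ha
      refine ⟨.inr c, hc, ?_⟩
      rintro (y | y) hy
      · exact (e0 y a hy).elim
      · exact congrArg _ (hu y hy)
  · rintro (a | a) ha
    · obtain ⟨c, c', hne, hc, hc'⟩ := h.centre ha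
      exact ⟨.inl c, .inl c', by simpa using hne, hc, hc'⟩
    · obtain ⟨c, c', hne, hc, hc'⟩ := hP.centre a ha
      exact ⟨.inr c, .inr c', by simpa using hne, hc, hc'⟩
  · rintro (a | a) (b | b) hab <;> rw [adj_iff] at hab
    · exact h.cover hab
    · rw [join_lab_lr] at hab
      obtain ⟨rfl, rfl⟩ : a = v ∧ b = p := by by_contra hc; simp [hc] at hab
      exact hcov
    · rw [join_lab_rl] at hab
      obtain ⟨rfl, rfl⟩ : b = v ∧ a = p := by by_contra hc; simp [hc] at hab
      rcases hcov with h' | h' | h' | h'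
      exacts [.inr (.inr (.inl h')), .inr (.inr (.inr h')), .inl h', .inr (.inl h')]
    · exact hP.cover a b hab
  · rintro (a | a) (b | b) ha hb hab <;> rw [adj_iff] at hab
    · exact h.indep ha hb hab
    · rw [join_lab_lr] at hab
      obtain ⟨rfl, rfl⟩ : a = v ∧ b = p := by by_contra hc; simp [hc] at hab
      exact hind hb ha
    · rw [join_lab_rl] at hab
      obtain ⟨rfl, rfl⟩ : b = v ∧ a = p := by by_contra hc; simp [hc] at hab
      exact hind ha hb
    · exact hab (hP.indep a ha b hb)
  · rintro (w | w) hw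
    · obtain ⟨x, hxv, h1, h2, h3, h4⟩ : ∃ x, (p ∈ Q₁ → x ≠ v) ∧ x ∉ A₁ ∧ x ∉ A₂ ∧
          T.graph.Adj w x ∧ ∀ w' ∈ A₁, T.graph.Adj w' x → w' = w := by
        by_cases hp : p ∈ Q₁
        · obtain ⟨x, h1, h2⟩ := hpriv hp w hw
          exact ⟨x, fun _ => h1, h2⟩
        · obtain ⟨x, h2⟩ := h.priv hw
          exact ⟨x, fun h' => (hp h').elim, h2⟩
      refine ⟨.inl x, h1, h2, h3, ?_⟩
      rintro (w' | w') hw' hadj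
      · exact congrArg _ (h4 w' hw' hadj)
      · rw [adj_iff, join_lab_rl] at hadj
        obtain ⟨rfl, rfl⟩ : x = v ∧ w' = p := by by_contra hc; simp [hc] at hadj
        exact (hxv hw' rfl).elim
    · by_cases hB : ∃ x, x ∉ Q₁ ∧ x ∉ Q₂ ∧ P.lab w x ≠ none ∧
          ∀ w' ∈ Q₁, P.lab w' x ≠ none → w' = w
      · obtain ⟨x, h1, h2, h3, h4⟩ := hB
        refine ⟨.inr x, h1, h2, h3, ?_⟩
        rintro (w' | w') hw' hadj
        · rw [adj_iff, join_lab_lr] at hadj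
          obtain ⟨rfl, rfl⟩ : w' = v ∧ x = p := by by_contra hc; simp [hc] at hadj
          rcases hP.covered w hw with h' | h'
          exacts [(h1 h').elim, (h2 h').elim]
        · exact congrArg _ (h4 w' hw' hadj)
      · obtain rfl : w = p := by
          by_contra hwp
          exact hB (hP.priv w hw hwp)
        rcases hprivp hw with h' | ⟨h1, h2, h3⟩
        · exact (hB h').elim
        · refine ⟨.inl v, h1, h2, by rw [adj_iff, join_lab_rl]; simp, ?_⟩
          rintro (w' | w') hw' hadj
          · exact (h3 w' hw' hadj).elim
          · rw [adj_iff, join_lab_rl] at hadj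
            obtain rfl : w' = w := by by_contra hc; simp [hc] at hadj
            rfl
  · rintro (a | a) (x | x) ha h1 h2 hadj <;> rw [adj_iff] at hadj
    · exact h.lab₁ ha h1 h2 hadj
    · rw [join_lab_lr] at hadj ⊢
      obtain ⟨rfl, rfl⟩ : a = v ∧ x = p := by by_contra hc; simp [hc] at hadj
      simpa using hl₁ ha h1 h2
    · rw [join_lab_rl] at hadj ⊢
      obtain ⟨rfl, rfl⟩ : x = v ∧ a = p := by by_contra hc; simp [hc] at hadj
      simpa using hl₃ ha h1 h2
    · exact (hP.lab₁ a ha x h1 h2).resolve_left hadj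
  · rintro (a | a) (x | x) ha h1 h2 hadj <;> rw [adj_iff] at hadj
    · exact h.lab₂ ha h1 h2 hadj
    · rw [join_lab_lr] at hadj ⊢
      obtain ⟨rfl, rfl⟩ : a = v ∧ x = p := by by_contra hc; simp [hc] at hadj
      simpa using hl₂ ha h1 h2
    · rw [join_lab_rl] at hadj ⊢
      obtain ⟨rfl, rfl⟩ : x = v ∧ a = p := by by_contra hc; simp [hc] at hadj
      simpa using hl₄ ha h1 h2
    · exact (hP.lab₂ a ha x h1 h2).resolve_left hadj

theorem isAttachable_nil : IsAttachable (path []) 0 ∅ ∅ where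
  adj_cases := by decide
  leaf := by decide
  centre := by decide
  cover := by decide
  indep := by decide
  priv := by decide
  lab₁ := by decide
  lab₂ := by decide
  covered := by decide

theorem isAttachable_five (p : Fin 5) (hp : p = 1 ∨ p = 2) :
    IsAttachable (path [L1, S, S, L1]) p {1, 3} {2} where
  adj_cases := by decide
  leaf := by decide
  centre := by decide
  cover := by decide
  indep := by decide
  priv := by revert p; decide
  lab₁ := by decide
  lab₂ := by decide
  covered := by revert p; decide

theorem isAttachable_four : IsAttachable (path [S, S, L1]) 0 {0, 2} {1} where
  adj_cases := by decide
  leaf := by decide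
  centre := by decide
  cover := by decide
  indep := by decide
  priv := by decide
  lab₁ := by decide
  lab₂ := by decide
  covered := by decide

/-- Attaching a path of two vertices to a centre, as a new leaf with its private neighbour, keeps
the labelled packing. -/
theorem IsLabelledPacking.join_leaf (h : IsLabelledPacking T A₁ A₂) (hv : v ∈ A₂) :
    IsLabelledPacking (T.join v (path [L1]) 0 S) {z | Sum.elim (· ∈ A₁) (· = 0) z}
      {z | Sum.elim (· ∈ A₂) (fun _ => False) z} := by
  have p00 : (path [L1]).lab 0 0 = none := by decide
  have p01 : (path [L1]).lab 0 1 = some L1 := by decide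
  have p10 : (path [L1]).lab 1 0 = some L1 := by decide
  have p11 : (path [L1]).lab 1 1 = none := by decide
  have hF : ∀ i : Fin ([L1].length + 1), i = 0 ∨ i = 1 := by decide
  have h10 : (1 : Fin ([L1].length + 1)) ≠ 0 := by decide
  have hS : ∀ a b, (T.join v (path [L1]) 0 S).sGraph.Adj a b ↔
      (∃ x y, a = .inl x ∧ b = .inl y ∧ T.sGraph.Adj x y) ∨ (a = .inl v ∧ b = .inr 0) ∨
      (a = .inr 0 ∧ b = .inl v) := by
    rintro (a | a) (b | b) <;> rw [sGraph_adj]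
    · simp [join_lab_ll, sGraph_adj]
    · rw [join_lab_lr]
      by_cases hc : a = v ∧ b = 0 <;> simp [hc]
    · rw [join_lab_rl]
      by_cases hc : b = v ∧ a = 0
      · simp [hc]
      · simp [hc]; tauto
    · rw [join_lab_rr]
      rcases hF a with rfl | rfl <;> rcases hF b with rfl | rfl <;> simp [p00, p01, p10, p11]
  have hG : ∀ a b, (T.join v (path [L1]) 0 S).graph.Adj a b ↔
      (∃ x y, a = .inl x ∧ b = .inl y ∧ T.graph.Adj x y) ∨ (a = .inl v ∧ b = .inr 0) ∨
      (a = .inr 0 ∧ b = .inl v) ∨ (a = .inr 0 ∧ b = .inr 1) ∨ (a = .inr 1 ∧ b = .inr 0) := by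
    rintro (a | a) (b | b) <;> rw [adj_iff]
    · simp [join_lab_ll, adj_iff]
    · rw [join_lab_lr]
      by_cases hc : a = v ∧ b = 0 <;> simp [hc]
    · rw [join_lab_rl]
      by_cases hc : b = v ∧ a = 0
      · simp [hc]
      · simp [hc]; tauto
    · rw [join_lab_rr]
      rcases hF a with rfl | rfl <;> rcases hF b with rfl | rfl <;>
        simp [p00, p01, p10, p11]
  have hv1 : v ∉ A₁ := fun h' => h.not_mem_both h' hv
  refine ⟨⟨?_, ?_, ?_, ?_, ?_, ?_, ?_⟩, ?_, ?_⟩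
  · intro a b hab
    rw [adj_iff, sGraph_adj.1 hab]
    simp
  · intro a b hab
    rcases (hS a b).1 hab with ⟨x, y, rfl, rfl, hxy⟩ | ⟨rfl, rfl⟩ | ⟨rfl, rfl⟩
    · exact h.adj_cases hxy
    · simp [hv]
    · simp [hv]
  · rintro (a | a) ha
    · obtain ⟨c, hc, hu⟩ := h.leaf ha
      refine ⟨.inl c, hc, fun y hy => ?_⟩
      rcases (hS _ _).1 hy with ⟨x, y, hx, rfl, hxy⟩ | ⟨h1, rfl⟩ | ⟨h1, rfl⟩
      · obtain rfl := Sum.inl.inj hx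
        exact congrArg _ (hu _ hxy)
      · obtain rfl := Sum.inl.inj h1
        exact (hv1 ha).elim
      · simp at h1
    · obtain rfl : a = 0 := ha
      refine ⟨.inl v, (hS _ _).2 (by simp), fun y hy => ?_⟩
      rcases (hS _ _).1 hy with ⟨x, y, hx, rfl, hxy⟩ | ⟨h1, rfl⟩ | ⟨h1, rfl⟩
      · simp at hx
      · simp at h1
      · rfl
  · rintro (a | a) ha
    · obtain ⟨c, c', hne, hc, hc'⟩ := h.centre ha
      exact ⟨.inl c, .inl c', by simpa using hne, hc, hc'⟩
    · exact ha.elim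
  · intro a b hab
    rcases (hG a b).1 hab with ⟨x, y, rfl, rfl, hxy⟩ | ⟨rfl, rfl⟩ | ⟨rfl, rfl⟩ | ⟨rfl, rfl⟩ |
      ⟨rfl, rfl⟩
    · exact h.cover hxy
    all_goals simp
  · intro a b ha hb hab
    rcases (hG a b).1 hab with ⟨x, y, rfl, rfl, hxy⟩ | ⟨rfl, rfl⟩ | ⟨rfl, rfl⟩ | ⟨rfl, rfl⟩ |
      ⟨rfl, rfl⟩
    · exact h.indep ha hb hxy
    · exact hv1 ha
    · exact hv1 hb
    · exact h10 hb
    · exact h10 ha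
  · rintro (w | w) hw
    · obtain ⟨x, h1, h2, h3, h4⟩ := h.priv hw
      refine ⟨.inl x, h1, h2, h3, ?_⟩
      intro w' hw' hadj
      rcases (hG _ _).1 hadj with ⟨y, z, rfl, hz, hxy⟩ | ⟨rfl, hz⟩ | ⟨rfl, hz⟩ | ⟨rfl, hz⟩ |
        ⟨rfl, hz⟩
      · obtain rfl := Sum.inl.inj hz
        exact congrArg _ (h4 y hw' hxy)
      · simp at hz
      · obtain rfl := Sum.inl.inj hz
        exact (h2 hv).elim
      · simp at hz
      · simp at hz
    · obtain rfl : w = 0 := hw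
      refine ⟨.inr 1, h10, fun h' => h', (hG _ _).2 (by simp), ?_⟩
      intro w' hw' hadj
      rcases (hG _ _).1 hadj with ⟨y, z, rfl, hz, hxy⟩ | ⟨rfl, hz⟩ | ⟨rfl, hz⟩ | ⟨rfl, hz⟩ |
        ⟨rfl, hz⟩
      · simp at hz
      · exact (h10 (Sum.inr.inj hz)).elim
      · rfl
      · rfl
      · exact (h10 (Sum.inr.inj hz)).elim
  · intro a x ha h1 h2 hadj
    rcases (hG _ _).1 hadj with ⟨y, z, rfl, rfl, hxy⟩ | ⟨rfl, rfl⟩ | ⟨rfl, rfl⟩ | ⟨rfl, rfl⟩ |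
        ⟨rfl, rfl⟩
    · exact h.lab₁ ha h1 h2 hxy
    · exact (hv1 ha).elim
    · exact (h2 hv).elim
    · exact p01
    · exact (h10 ha).elim
  · intro a x ha h1 h2 hadj
    rcases (hG _ _).1 hadj with ⟨y, z, rfl, rfl, hxy⟩ | ⟨rfl, rfl⟩ | ⟨rfl, rfl⟩ | ⟨rfl, rfl⟩ |
        ⟨rfl, rfl⟩
    · exact h.lab₂ ha h1 h2 hxy
    · exact (h1 rfl).elim
    · exact ha.elim
    · exact ha.elim
    · exact ha.elim

end Join

/-! ### Labelled trees of the family are labelled packings -/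

/-- If the non-leaf edges are the edges joining `c` to the vertices of an independent set with at
least two elements, then a leaf edge is adjacent to two of them exactly when it contains `c`. -/
theorem exists_two_nonLeafEdges_iff {V : Type u} {G : SimpleGraph V} {c : V} {A : Set V}
    (hN : ∀ e, IsNonLeafEdge G e ↔ ∃ w ∈ A, e = s(c, w)) (hA : ∃ w ∈ A, ∃ w' ∈ A, w ≠ w')
    (hind : ∀ a ∈ A, ∀ b ∈ A, ¬ G.Adj a b) {a b : V} (hab : G.Adj a b)
    (hl : ¬ IsNonLeafEdge G s(a, b)) :
    (∃ f g, f ≠ g ∧ IsNonLeafEdge G f ∧ IsNonLeafEdge G g ∧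
      EdgeAdj s(a, b) f ∧ EdgeAdj s(a, b) g) ↔ a = c ∨ b = c := by
  constructor
  · rintro ⟨f, g, hne, hf, hg, ⟨-, x, hx, hxf⟩, ⟨-, y, hy, hyg⟩⟩
    obtain ⟨w, hw, rfl⟩ := (hN _).1 hf
    obtain ⟨w', hw', rfl⟩ := (hN _).1 hg
    have hww : w ≠ w' := by rintro rfl; exact hne rfl
    by_contra hc
    push Not at hc
    rcases Sym2.mem_iff.1 hx with rfl | rfl <;> rcases Sym2.mem_iff.1 hy with rfl | rfl
    · have h2 : y = w := by simpa [hc.1] using hxf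
      have h3 : y = w' := by simpa [hc.1] using hyg
      exact hww (h2.symm.trans h3)
    · have h2 : x = w := by simpa [hc.1] using hxf
      have h3 : y = w' := by simpa [hc.2] using hyg
      subst h2 h3
      exact hind _ hw _ hw' hab
    · have h2 : x = w := by simpa [hc.2] using hxf
      have h3 : y = w' := by simpa [hc.1] using hyg
      subst h2 h3
      exact hind _ hw' _ hw hab
    · have h2 : y = w := by simpa [hc.2] using hxf
      have h3 : y = w' := by simpa [hc.2] using hyg
      exact hww (h2.symm.trans h3)
  · intro hc
    obtain ⟨w, hw, w', hw', hne⟩ := hA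
    have hadj : ∀ w ∈ A, EdgeAdj s(a, b) s(c, w) := by
      intro w hw
      refine ⟨fun e => hl ((hN _).2 ⟨w, hw, e⟩), c, ?_, by simp⟩
      rcases hc with rfl | rfl <;> simp
    refine ⟨s(c, w), s(c, w'), ?_, (hN _).2 ⟨w, hw, rfl⟩, (hN _).2 ⟨w', hw', rfl⟩,
      hadj w hw, hadj w' hw'⟩
    exact fun e => hne (by grind)

/-- A tree of diameter four has a central vertex within distance two of every vertex, with two
neighbours that are not leaves. -/
theorem exists_centre_of_diam_eq_four {V : Type u} {G : SimpleGraph V} (hG : G.IsTree)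
    (hd : G.diam = 4) :
    ∃ c, (∀ z, G.dist c z ≤ 2) ∧ ∃ a u b v, a ≠ b ∧ G.Adj c a ∧ G.Adj a u ∧ u ≠ c ∧
      G.Adj c b ∧ G.Adj b v ∧ v ≠ c := by
  have : Nonempty V := hG.connected.nonempty
  have hle : ∀ a b, G.dist a b ≤ 4 := fun a b => hd ▸
    SimpleGraph.dist_le_diam (SimpleGraph.ediam_ne_top_of_diam_ne_zero (by omega))
  obtain ⟨u, v, huv⟩ := G.exists_dist_eq_diam
  obtain ⟨p, hp, hl⟩ := hG.connected.exists_path_of_dist u v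
  rw [huv, hd] at hl
  match p, hp, hl with
  | .cons (v := a) h₁ (.cons (v := c) h₂ (.cons (v := b) h₃ (.cons h₄ .nil))), hp, _ =>
    simp only [SimpleGraph.Walk.isPath_def, SimpleGraph.Walk.support_cons,
      SimpleGraph.Walk.support_nil, List.nodup_cons, List.mem_cons, List.not_mem_nil, or_false,
      not_or] at hp
    obtain ⟨⟨-, huc, -, -⟩, ⟨-, hab, -⟩, ⟨-, hcv⟩, -⟩ := hp
    refine ⟨c, ?_, a, u, b, v, hab, h₂.symm, h₁.symm, huc, h₃, h₄, fun e => hcv e.symm⟩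
    by_contra hcon
    push Not at hcon
    obtain ⟨z, hz⟩ := hcon
    have hdesc : ∀ n z, G.dist c z = n + 3 → ∃ z, G.dist c z = 3 := by
      intro n
      induction n with
      | zero => exact fun z hz => ⟨z, hz⟩
      | succ n ih =>
        intro z hz
        obtain ⟨y, -, hy⟩ := exists_parent hG (r := c) (x := z) (by rintro rfl; simp at hz)
        exact ih y (by omega)
    obtain ⟨z₃, hz₃⟩ := hdesc (G.dist c z - 3) z (by omega)
    obtain ⟨z₂, hz₃₂, hz₂⟩ := exists_parent hG (r := c) (x := z₃) (by rintro rfl; simp at hz₃)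
    have hz₂' : G.dist c z₂ = 2 := by omega
    obtain ⟨z₁, hz₂₁, hz₁⟩ := exists_parent hG (r := c) (x := z₂) (by rintro rfl; simp at hz₂')
    have hz₁' : G.dist c z₁ = 1 := by omega
    have hcz₁ : G.Adj c z₁ := SimpleGraph.dist_eq_one_iff_adj.1 hz₁'
    -- a vertex at distance three from `c` would be at distance five from an end of the path
    have key : ∀ a u, G.Adj c a → G.Adj a u → u ≠ c → z₁ ≠ a → False := by
      intro a u hca hau huc hza
      have hda : G.dist c a = 1 := SimpleGraph.dist_eq_one_iff_adj.2 hca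
      have hdu : G.dist c u = 2 := by
        rw [dist_eq_length_of_isPath hG (.cons hca (.cons hau .nil))
          (by simp [hca.ne, hau.ne, huc.symm])]
        rfl
      have hzu : z₂ ≠ u := by
        rintro rfl
        exact hza (parent_unique hG (r := c) hz₂₁.symm hau (by omega) (by omega))
      have hne : ∀ {x y}, G.dist c x ≠ G.dist c y → x ≠ y := by
        rintro x y h rfl; exact h rfl
      have hd0 : G.dist c c = 0 := by simp
      have := hle z₃ u
      rw [dist_eq_length_of_isPath hG
        (.cons hz₃₂ (.cons hz₂₁ (.cons hcz₁.symm (.cons hca (.cons hau .nil)))))] at this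
      · simp at this
      · simp only [SimpleGraph.Walk.isPath_def, SimpleGraph.Walk.support_cons,
          SimpleGraph.Walk.support_nil, List.nodup_cons, List.mem_cons, List.not_mem_nil, or_false,
          not_or, not_false_eq_true, and_true, List.nodup_nil]
        refine ⟨⟨hne ?_, hne ?_, hne ?_, hne ?_, hne ?_⟩, ⟨hne ?_, hne ?_, hne ?_, hzu⟩,
          ⟨hne ?_, hza, hne ?_⟩, ⟨hne ?_, huc.symm⟩, hau.ne⟩ <;> omega
    by_cases h : z₁ = a
    · exact key b v h₃ h₄ (fun e => hcv e.symm) (h ▸ hab)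
    · exact key a u h₂.symm h₁.symm huc h

theorem isLabelledPacking_initial {V : Type u} {T : LGraph V} (hT : T.graph.IsTree)
    (hd : T.graph.diam = 4) (hlab : T.IsInitialLabelling) :
    ∃ A₁ A₂, IsLabelledPacking T A₁ A₂ := by
  obtain ⟨c, hc, a, u, b, v, hab, hca, hau, huc, hcb, hbv, hvc⟩ :=
    exists_centre_of_diam_eq_four hT hd
  set G := T.graph with hG
  set A : Set V := {w | G.Adj c w ∧ ∃ x, x ≠ c ∧ G.Adj w x} with hA
  have haA : a ∈ A := ⟨hca, u, huc, hau⟩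
  have hbA : b ∈ A := ⟨hcb, v, hvc, hbv⟩
  have hd1 : ∀ {x}, G.Adj c x → G.dist c x = 1 := SimpleGraph.dist_eq_one_iff_adj.2
  have hdc : G.dist c c = 0 := by simp
  have hcA : c ∉ A := fun h => h.1.ne rfl
  have hstep : ∀ {x y}, G.Adj x y → G.dist c x = G.dist c y + 1 ∨ G.dist c y = G.dist c x + 1 :=
    fun h => hT.dist_eq_dist_add_one_of_adj c h
  have hind : ∀ x ∈ A, ∀ y ∈ A, ¬ G.Adj x y := by
    intro x hx y hy hxy
    have h1 := hd1 hx.1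
    have h2 := hd1 hy.1
    have h3 := hstep hxy
    omega
  have hnc : ∀ {x}, x ≠ c → G.dist c x ≠ 0 := by
    intro x hx h0
    exact hx ((hT.connected.dist_eq_zero_iff).1 h0).symm
  -- an edge avoiding `c` joins a vertex of `A` to a vertex of degree one
  have hout : ∀ {x y}, G.Adj x y → x ≠ c → y ≠ c →
      (x ∈ A ∧ y ∉ A ∧ ∀ z, G.Adj y z → z = x) ∨ (y ∈ A ∧ x ∉ A ∧ ∀ z, G.Adj x z → z = y) := by
    have key : ∀ {x y}, G.Adj x y → x ≠ c → y ≠ c → G.dist c y = G.dist c x + 1 →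
        (x ∈ A ∧ y ∉ A ∧ ∀ z, G.Adj y z → z = x) := by
      intro x y hxy hx hy hd
      have h1 := hc y
      have h2 := hnc hx
      refine ⟨⟨SimpleGraph.dist_eq_one_iff_adj.1 (by omega), y, hy, hxy⟩, ?_, ?_⟩
      · intro hyA
        have := hd1 hyA.1
        omega
      · intro z hz
        have h3 := hc z
        have h4 := hstep hz
        exact parent_unique hT (r := c) hz.symm hxy (by omega) (by omega)
    intro x y hxy hx hy
    rcases hstep hxy with h | h
    · exact .inr (key hxy.symm hy hx h)
    · exact .inl (key hxy hx hy h)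
  have hcl : ∀ {x}, G.Adj c x → x ∉ A → ∀ z, G.Adj x z → z = c := by
    intro x hx hxA z hz
    by_contra hzc
    exact hxA ⟨hx, z, hzc, hz⟩
  have hN : ∀ e, IsNonLeafEdge G e ↔ ∃ w ∈ A, e = s(c, w) := by
    intro e
    constructor
    · induction e with
      | _ x y =>
        rintro ⟨hxy, hl⟩
        have hxy' : G.Adj x y := hxy
        by_cases hx : x = c
        · subst hx
          by_contra hcon
          refine hl ⟨y, by simp, x, hxy'.symm, hcl hxy' fun h => hcon ⟨y, h, rfl⟩⟩
        by_cases hy : y = c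
        · subst hy
          by_contra hcon
          exact hl ⟨x, by simp, y, hxy', hcl hxy'.symm fun h => hcon ⟨x, h, Sym2.eq_swap⟩⟩
        exfalso
        rcases hout hxy' hx hy with h | h
        · exact hl ⟨y, by simp, x, hxy'.symm, h.2.2⟩
        · exact hl ⟨x, by simp, y, hxy', h.2.2⟩
    · rintro ⟨w, ⟨hcw, x, hxc, hwx⟩, rfl⟩
      refine ⟨hcw, ?_⟩
      rintro ⟨z, hz, hl⟩
      rcases Sym2.mem_iff.1 hz with rfl | rfl
      · exact hab (hl.unique hca hcb)
      · exact hxc (hl.unique hwx hcw.symm)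
  have hleaf : ∀ {x y}, G.Adj x y → ¬ IsNonLeafEdge G s(x, y) → IsLeafEdge G s(x, y) := by
    intro x y hxy hn
    refine ⟨hxy, ?_⟩
    by_contra h
    exact hn ⟨hxy, h⟩
  have htwo := fun {x y} (hxy : G.Adj x y) hl =>
    exists_two_nonLeafEdges_iff hN ⟨a, haA, b, hbA, hab⟩ hind hxy hl
  have hL2 : ∀ {x y}, G.Adj x y → ¬ IsNonLeafEdge G s(x, y) → (x = c ∨ y = c) →
      T.lab x y = some L2 := fun hxy hl h =>
    ((hlab _ _ hxy).2 (hleaf hxy hl)).1 ((htwo hxy hl).2 h)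
  have hL1 : ∀ {x y}, G.Adj x y → ¬ IsNonLeafEdge G s(x, y) → ¬ (x = c ∨ y = c) →
      T.lab x y = some L1 := fun hxy hl h =>
    ((hlab _ _ hxy).2 (hleaf hxy hl)).2 (mt (htwo hxy hl).1 h)
  have hS : ∀ {x y}, T.sGraph.Adj x y ↔ IsNonLeafEdge G s(x, y) := by
    intro x y
    rw [sGraph_adj]
    constructor
    · intro hs
      have hxy : G.Adj x y := by rw [hG, adj_iff, hs]; simp
      by_contra hn
      by_cases h : x = c ∨ y = c
      · rw [hL2 hxy hn h] at hs; simp at hs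
      · rw [hL1 hxy hn h] at hs; simp at hs
    · intro h
      exact (hlab _ _ h.1).1 h
  have hS' : ∀ {x y}, T.sGraph.Adj x y ↔ (x ∈ A ∧ y = c) ∨ (x = c ∧ y ∈ A) := by
    intro x y
    rw [hS, hN]
    constructor
    · rintro ⟨w, hw, h⟩
      rcases Sym2.eq_iff.1 h with ⟨rfl, rfl⟩ | ⟨rfl, rfl⟩
      exacts [.inr ⟨rfl, hw⟩, .inl ⟨hw, rfl⟩]
    · rintro (⟨hx, rfl⟩ | ⟨rfl, hy⟩)
      exacts [⟨x, hx, Sym2.eq_swap⟩, ⟨y, hy, rfl⟩]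
  refine ⟨A, {c}, ⟨⟨?_, ?_, ?_, ?_, ?_, ?_, ?_⟩, ?_, ?_⟩⟩
  · intro x y h
    exact (hS.1 h).1
  · intro x y h
    exact hS'.1 h
  · intro x hx
    refine ⟨c, hS'.2 (.inl ⟨hx, rfl⟩), fun y hy => ?_⟩
    rcases hS'.1 hy with h | h
    · exact h.2
    · exact (hcA (h.1 ▸ hx)).elim
  · rintro x rfl
    exact ⟨a, b, hab, hS'.2 (.inr ⟨rfl, haA⟩), hS'.2 (.inr ⟨rfl, hbA⟩)⟩
  · intro x y hxy
    by_cases hx : x = c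
    · exact .inr (.inl hx)
    by_cases hy : y = c
    · exact .inr (.inr (.inr hy))
    rcases hout hxy hx hy with h | h
    · exact .inl h.1
    · exact .inr (.inr (.inl h.1))
  · intro x y hx hy
    exact hind x hx y hy
  · rintro w ⟨hcw, x, hxc, hwx⟩
    have hwA : w ∈ A := ⟨hcw, x, hxc, hwx⟩
    have hl : x ∉ A ∧ ∀ z, G.Adj x z → z = w := by
      rcases hout hwx hcw.ne.symm hxc with h | h
      · exact h.2
      · exact (h.2.1 hwA).elim
    exact ⟨x, hl.1, hxc, hwx, fun w' _ h => hl.2 w' h.symm⟩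
  · intro w x hw hx hxc hwx
    refine hL1 hwx ?_ ?_
    · rw [← hS, hS']
      rintro (h | h)
      exacts [hxc h.2, hx h.2]
    · rintro (rfl | rfl)
      exacts [hcA hw, hxc rfl]
  · rintro y x rfl hx hxc hyx
    refine hL2 hyx ?_ (.inl rfl)
    rw [← hS, hS']
    rintro (h | h)
    exacts [hxc h.2, hx h.2]

/-- Every operation preserves labelled packings, so every labelled tree of the family is one. -/
theorem FamilyTt.isLabelledPacking {V : Type u} {T : LGraph V} (hT : FamilyTt T) :
    IsLabelledPacking T T.classA1 T.classA2 := by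
  induction hT with
  | initial T tree diam lab =>
    obtain ⟨A₁, A₂, h⟩ := isLabelledPacking_initial tree diam lab
    exact h.congr_classes
  | iso T T' e he _ ih => exact (ih.of_equiv e he).congr_classes
  | op1_A1 T v _ hv ih =>
    exact (ih.join isAttachable_nil (by simp) (.inl hv) (by simp) (by simp) (by simp)
      (fun _ _ _ => rfl) (fun h => (ih.not_mem_both hv h).elim) (by simp) (by simp)).congr_classes
  | op1_A2 T v _ hv ih =>
    exact (ih.join isAttachable_nil (by simp) (.inr (.inl hv)) (by simp) (by simp) (by simp)
      (fun h => (ih.not_mem_both h hv).elim) (fun _ _ _ => rfl) (by simp) (by simp)).congr_classes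
  | op2 T v _ hv ih => exact (ih.join_leaf hv).congr_classes
  | op3 T v _ hv hC ih =>
    refine (ih.join (isAttachable_five 1 (by simp)) (by simp) (.inr (.inr (.inl (by decide))))
      (fun _ => hv) (fun _ w hw => ih.exists_private_ne hC hw) (fun _ => .inl ⟨0, by decide⟩)
      (fun h => (hv h).elim) (fun _ h => absurd (by decide) h) (fun _ _ _ => rfl)
      (fun h => absurd h (by decide))).congr_classes
  | op4 T v _ hv ih =>
    obtain ⟨h1, h2, h3⟩ := ih.uncovered_of_mem_classB hv
    refine (ih.join isAttachable_four (by simp) (.inr (.inr (.inl (by decide))))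
      (fun _ => h1) (fun _ w hw => ?_) (fun _ => .inr ⟨h1, h2, h3⟩)
      (fun h => (h1 h).elim) (fun _ h => absurd (by decide) h) (fun _ _ _ => rfl)
      (fun h => absurd h (by decide))).congr_classes
    obtain ⟨x, hx1, hx2, hx3, hx4⟩ := ih.priv hw
    exact ⟨x, by rintro rfl; exact h3 w hw hx3, hx1, hx2, hx3, hx4⟩
  | op5 T v _ ih =>
    exact (ih.join (isAttachable_five 2 (by simp)) (by simp) (.inr (.inr (.inr (by decide))))
      (fun h => absurd h (by decide)) (fun h => absurd h (by decide))
      (fun h => absurd h (by decide)) (fun _ _ h => absurd (by decide) h)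
      (fun _ _ h => absurd (by decide) h)
      (fun h => absurd h (by decide)) (fun _ _ _ => rfl)).congr_classes

/-! ### Undoing an operation -/

theorem IsLabelledPacking.of_isStarPacking {V : Type u} {T : LGraph V} {A₁ A₂ B₁ B₂ : Set V}
    (h : IsLabelledPacking T A₁ A₂) (h' : IsStarPacking T.graph T.sGraph B₁ B₂) :
    IsLabelledPacking T B₁ B₂ := by
  have e₁ : A₁ = B₁ := Set.ext fun _ => h.mem_left_iff.trans h'.mem_left_iff.symm
  have e₂ : A₂ = B₂ := Set.ext fun _ => h.mem_right_iff.trans h'.mem_right_iff.symm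
  rwa [e₁, e₂] at h

section Cut

variable {V : Type u} {G D : SimpleGraph V} {A₁ A₂ : Set V}

/-- The graph `G` has a labelling in the family for which `D` is the graph of `S`-edges. -/
def HasFamilyLabelling (G D : SimpleGraph V) : Prop :=
  ∃ T : LGraph V, T.graph = G ∧ T.sGraph = D ∧ FamilyTt T

/-- If only the vertex `v` of `s` has neighbours outside `s`, then `s` induces a subtree:
retracting everything outside `s` to `v` maps edges to edges or vertices. -/
theorem isTree_induce (hG : G.IsTree) {s : Set V} (v : s)
    (hv : ∀ a ∈ s, ∀ b, b ∉ s → G.Adj a b → a = v) : (G.induce s).IsTree := by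
  classical
  refine ⟨?_, hG.isAcyclic.induce s⟩
  let r : V → s := fun x => if h : x ∈ s then ⟨x, h⟩ else v
  have hr : ∀ x (h : x ∈ s), r x = ⟨x, h⟩ := fun x h => dif_pos h
  have hr' : ∀ x, x ∉ s → r x = v := fun x h => dif_neg h
  have hreach : ∀ {x y}, G.Walk x y → (G.induce s).Reachable (r x) (r y) := by
    intro x y p
    induction p with
    | nil => exact .refl _
    | @cons x y z h q ih =>
      refine .trans ?_ ih
      by_cases hx : x ∈ s <;> by_cases hy : y ∈ s
      · rw [hr x hx, hr y hy]
        exact SimpleGraph.Adj.reachable (by simpa using h)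
      · rw [hr' y hy, hr x hx]
        obtain rfl := hv x hx y hy h
        exact .refl _
      · rw [hr' x hx, hr y hy]
        obtain rfl := hv y hy x hx h.symm
        exact .refl _
      · rw [hr' x hx, hr' y hy]
  have : Nonempty s := ⟨v⟩
  refine ⟨fun a b => ?_⟩
  obtain ⟨p⟩ := hG.connected a b
  have := hreach p
  rwa [hr _ a.2, hr _ b.2] at this

theorem IsStarPacking.induce (h : IsStarPacking G D A₁ A₂) {s : Set V}
    (hleaf : ∀ a ∈ A₁, a ∈ s → ∀ c, D.Adj a c → c ∈ s)
    (hcentre : ∀ c ∈ A₂, c ∈ s → ∃ w w', w ≠ w' ∧ D.Adj c w ∧ D.Adj c w' ∧ w ∈ s ∧ w' ∈ s)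
    (hpriv : ∀ w ∈ A₁, w ∈ s → ∃ x, x ∈ s ∧ x ∉ A₁ ∧ x ∉ A₂ ∧ G.Adj w x ∧
      ∀ w' ∈ A₁, G.Adj w' x → w' = w) :
    IsStarPacking (G.induce s) (D.induce s) {x | (x : V) ∈ A₁} {x | (x : V) ∈ A₂} where
  le h' := h.le h'
  adj_cases h' := h.adj_cases h'
  leaf := by
    rintro ⟨a, has⟩ ha
    obtain ⟨c, hc, hu⟩ := h.leaf ha
    exact ⟨⟨c, hleaf a ha has c hc⟩, hc, fun y hy => Subtype.ext (hu _ hy)⟩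
  centre := by
    rintro ⟨c, hcs⟩ hc
    obtain ⟨w, w', hne, h1, h2, h3, h4⟩ := hcentre c hc hcs
    exact ⟨⟨w, h3⟩, ⟨w', h4⟩, by simpa using hne, h1, h2⟩
  cover h' := h.cover h'
  indep ha hb h' := h.indep ha hb h'
  priv := by
    rintro ⟨w, hws⟩ hw
    obtain ⟨x, h1, h2, h3, h4, h5⟩ := hpriv w hw hws
    exact ⟨⟨x, h1⟩, h2, h3, h4, fun w' hw' h' => Subtype.ext (h5 _ hw' h')⟩

/-- Let the vertices `g i` of `G` form a copy of `P` joined to the other vertices by a single edge,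
from `g p` to `v`. If the remaining vertices form a tree with a family labelling, and joining `P` to
it by an edge labelled `ℓ` is a legitimate operation, then `G` has a family labelling. -/
theorem HasFamilyLabelling.of_cut (hG : G.IsTree) (h : IsStarPacking G D A₁ A₂)
    (IH : ∀ s : Set V, s ≠ Set.univ → (G.induce s).IsTree →
      IsStarPacking (G.induce s) (D.induce s) {x | (x : V) ∈ A₁} {x | (x : V) ∈ A₂} →
      (∃ c ∈ s, c ∈ A₂) → HasFamilyLabelling (G.induce s) (D.induce s))
    {W : Type} (P : LGraph W) (p : W) (g : W → V) (hg : Function.Injective g) {v : V}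
    (hv : v ∉ Set.range g) (ℓ : EdgeLabel)
    (hGadj : ∀ i x, G.Adj (g i) x ↔ (∃ j, x = g j ∧ P.lab i j ≠ none) ∨ (i = p ∧ x = v))
    (hDadj : ∀ i x, D.Adj (g i) x ↔ (∃ j, x = g j ∧ P.lab i j = some S) ∨
      (i = p ∧ x = v ∧ ℓ = S))
    (hS : ℓ = S → v ∈ A₂ ∧ ∃ w w', w ≠ w' ∧ D.Adj v w ∧ D.Adj v w' ∧ w ∉ Set.range g ∧
      w' ∉ Set.range g)
    (hpriv : v ∈ A₁ → ∃ x, x ∉ Set.range g ∧ x ∉ A₁ ∧ x ∉ A₂ ∧ G.Adj v x ∧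
      ∀ w' ∈ A₁, G.Adj w' x → w' = v)
    (hcentre : ∃ c ∈ A₂, c ∉ Set.range g)
    (hop : ∀ T : LGraph ((Set.range g)ᶜ : Set V), T.graph = G.induce (Set.range g)ᶜ →
      FamilyTt T → IsLabelledPacking T {x | (x : V) ∈ A₁} {x | (x : V) ∈ A₂} →
      FamilyTt (T.join ⟨v, hv⟩ P p ℓ)) : HasFamilyLabelling G D := by
  classical
  set s : Set V := (Set.range g)ᶜ with hs
  have hnot : ∀ {x}, x ∉ s → ∃ i, g i = x := by
    intro x hx
    simpa [hs] using hx
  have hgs : ∀ i, g i ∉ s := fun i => by simp [hs]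
  have hcross : ∀ a ∈ s, ∀ i, G.Adj a (g i) → a = v ∧ i = p := by
    intro a ha i hai
    rcases (hGadj i a).1 hai.symm with ⟨j, rfl, -⟩ | ⟨rfl, rfl⟩
    exacts [(hgs j ha).elim, ⟨rfl, rfl⟩]
  have hcrossD : ∀ a ∈ s, ∀ i, D.Adj a (g i) → ℓ = S ∧ a = v := by
    intro a ha i hai
    rcases (hDadj i a).1 hai.symm with ⟨j, rfl, -⟩ | ⟨rfl, rfl, h'⟩
    exacts [(hgs j ha).elim, ⟨h', rfl⟩]
  have htree : (G.induce s).IsTree := by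
    refine isTree_induce hG ⟨v, hv⟩ fun a ha b hb hab => ?_
    obtain ⟨i, rfl⟩ := hnot hb
    exact (hcross a ha i hab).1
  have hpack : IsStarPacking (G.induce s) (D.induce s) {x | (x : V) ∈ A₁}
      {x | (x : V) ∈ A₂} := by
    refine h.induce ?_ ?_ ?_
    · intro a ha has c hc
      by_contra hcs
      obtain ⟨i, rfl⟩ := hnot hcs
      obtain ⟨hℓ, rfl⟩ := hcrossD a has i hc
      exact h.not_mem_both ha (hS hℓ).1
    · intro c hc hcs
      by_cases hcv : ℓ = S ∧ c = v
      · obtain ⟨hℓ, rfl⟩ := hcv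
        exact (hS hℓ).2
      · have hin : ∀ w, D.Adj c w → w ∈ s := by
          intro w hw
          by_contra hws
          obtain ⟨i, rfl⟩ := hnot hws
          exact hcv (hcrossD c hcs i hw)
        obtain ⟨w, w', hne, h1, h2⟩ := h.centre hc
        exact ⟨w, w', hne, h1, h2, hin w h1, hin w' h2⟩
    · intro w hw hws
      by_cases hwv : w = v
      · subst hwv; exact hpriv hw
      · obtain ⟨x, h1, h2, h3, h4⟩ := h.priv hw
        refine ⟨x, ?_, h1, h2, h3, h4⟩
        by_contra hxs
        obtain ⟨i, rfl⟩ := hnot hxs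
        exact hwv (hcross w hws i h3).1
  obtain ⟨T, hTG, hTD, hT⟩ := IH s (fun e => hgs p (e ▸ Set.mem_univ _)) htree hpack
    (by obtain ⟨c, h1, h2⟩ := hcentre; exact ⟨c, h2, h1⟩)
  have hgood : IsLabelledPacking T {x | (x : V) ∈ A₁} {x | (x : V) ∈ A₂} := by
    have hp := hpack
    rw [← hTG, ← hTD] at hp
    exact hT.isLabelledPacking.of_isStarPacking hp
  have hfam := hop T hTG hT hgood
  let e : s ⊕ W ≃ V := Equiv.ofBijective (Sum.elim Subtype.val g) (by
    constructor
    · rintro (a | i) (b | j) hab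
      · exact congrArg _ (Subtype.ext hab)
      · exact (hgs j (show g j ∈ s from (show a = g j from hab) ▸ a.2)).elim
      · exact (hgs i (show g i ∈ s from (show g i = b from hab) ▸ b.2)).elim
      · exact congrArg _ (hg hab)
    · intro x
      by_cases hx : x ∈ s
      · exact ⟨.inl ⟨x, hx⟩, rfl⟩
      · obtain ⟨i, rfl⟩ := hnot hx
        exact ⟨.inr i, rfl⟩)
  have el : ∀ a : s, e (.inl a) = a := fun a => rfl
  have er : ∀ i, e (.inr i) = g i := fun i => rfl
  let J := T.join ⟨v, hv⟩ P p ℓ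
  let T' : LGraph V :=
    { lab := fun a b => J.lab (e.symm a) (e.symm b)
      symm := fun a b => J.symm _ _
      irrefl := fun a => J.irrefl _ }
  have hlab : ∀ a b, T'.lab (e a) (e b) = J.lab a b := fun a b => by simp [T']
  have hcrossG : ∀ (a : s) i, J.lab (.inl a) (.inr i) ≠ none ↔ G.Adj a (g i) := by
    intro a i
    rw [join_lab_lr]
    constructor
    · intro h'
      obtain ⟨rfl, rfl⟩ : a = ⟨v, hv⟩ ∧ i = p := by by_contra hc; simp [hc] at h'
      exact ((hGadj i v).2 (.inr ⟨rfl, rfl⟩)).symm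
    · intro h'
      obtain ⟨h1, h2⟩ := hcross a a.2 i h'
      rw [if_pos ⟨Subtype.ext h1, h2⟩]
      simp
  have hcrossD' : ∀ (a : s) i, J.lab (.inl a) (.inr i) = some S ↔ D.Adj a (g i) := by
    intro a i
    rw [join_lab_lr]
    constructor
    · intro h'
      obtain ⟨rfl, rfl⟩ : a = ⟨v, hv⟩ ∧ i = p := by by_contra hc; simp [hc] at h'
      exact ((hDadj i v).2 (.inr ⟨rfl, rfl, by simpa using h'⟩)).symm
    · intro h'
      have h2 := (hcross a a.2 i (h.le h')).2
      obtain ⟨hℓ, h1⟩ := hcrossD a a.2 i h'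
      rw [if_pos ⟨Subtype.ext h1, h2⟩, hℓ]
  refine ⟨T', ?_, ?_, FamilyTt.iso J T' e hlab hfam⟩
  · ext a b
    obtain ⟨a, rfl⟩ := e.surjective a
    obtain ⟨b, rfl⟩ := e.surjective b
    rw [adj_iff, hlab]
    rcases a with a | i <;> rcases b with b | j
    · rw [join_lab_ll, ← adj_iff, hTG]; rfl
    · exact hcrossG a j
    · rw [J.symm, SimpleGraph.adj_comm]
      exact hcrossG b i
    · rw [join_lab_rr, er, er, hGadj]
      constructor
      · exact fun h' => .inl ⟨j, rfl, h'⟩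
      · rintro (⟨k, hk, h'⟩ | ⟨-, h'⟩)
        · rwa [hg hk]
        · exact (hv ⟨j, h'⟩).elim
  · ext a b
    obtain ⟨a, rfl⟩ := e.surjective a
    obtain ⟨b, rfl⟩ := e.surjective b
    rw [sGraph_adj, hlab]
    rcases a with a | i <;> rcases b with b | j
    · rw [join_lab_ll, ← sGraph_adj, hTD]; rfl
    · exact hcrossD' a j
    · rw [J.symm, SimpleGraph.adj_comm]
      exact hcrossD' b i
    · rw [join_lab_rr, er, er, hDadj]
      constructor
      · exact fun h' => .inl ⟨j, rfl, h'⟩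
      · rintro (⟨k, hk, h'⟩ | ⟨-, h', -⟩)
        · rwa [hg hk]
        · exact (hv ⟨j, h'⟩).elim

end Cut

/-! ### Deepest stars -/

/-- `x` is a pendant uncovered neighbour of `w`. -/
def IsPendant {V : Type u} (G : SimpleGraph V) (A₁ A₂ : Set V) (w x : V) : Prop :=
  x ∉ A₁ ∧ x ∉ A₂ ∧ G.Adj w x ∧ ∀ y, G.Adj x y → y = w

section Deep

variable {V : Type u} {G D : SimpleGraph V} {A₁ A₂ : Set V}

/-- In a tree rooted at `r`, an uncovered vertex at least as deep as the deepest centre has no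
children. -/
theorem IsStarPacking.dist_lt_of_deep (h : IsStarPacking G D A₁ A₂) (hG : G.IsTree) {r c : V}
    (hmax : ∀ c' ∈ A₂, G.dist r c' ≤ G.dist r c) {q y : V} (hq₁ : q ∉ A₁) (hq₂ : q ∉ A₂)
    (hd : G.dist r c ≤ G.dist r q) (hqy : G.Adj q y) : G.dist r y < G.dist r q := by
  by_contra hlt
  have hdy := hG.dist_eq_dist_add_one_of_adj r hqy
  rcases h.cover hqy with h' | h' | h' | h'
  · exact hq₁ h'
  · exact hq₂ h'
  · obtain ⟨k, hk, -⟩ := h.leaf h'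
    have hk2 := h.mem_right_of_mem_left h' hk
    have hdk := hG.dist_eq_dist_add_one_of_adj r (h.le hk)
    have hm := hmax k hk2
    have : k = q := parent_unique hG (r := r) (h.le hk).symm hqy (by omega) (by omega)
    exact hq₂ (this ▸ hk2)
  · have hm := hmax y h'
    omega

/-- A child of a vertex at least as deep as the deepest centre is joined to it by a star edge or is
a pendant uncovered vertex. -/
theorem IsStarPacking.adj_or_isPendant (h : IsStarPacking G D A₁ A₂) (hG : G.IsTree) {r c : V}
    (hmax : ∀ c' ∈ A₂, G.dist r c' ≤ G.dist r c) {z q : V} (hzq : G.Adj z q)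
    (hd : G.dist r q = G.dist r z + 1) (hz : G.dist r c ≤ G.dist r z) :
    D.Adj z q ∨ IsPendant G A₁ A₂ z q := by
  by_cases h1 : q ∈ A₁
  · obtain ⟨k, hk, -⟩ := h.leaf h1
    have hk2 := h.mem_right_of_mem_left h1 hk
    have hdk := hG.dist_eq_dist_add_one_of_adj r (h.le hk)
    have hm := hmax k hk2
    have : k = z := parent_unique hG (r := r) (h.le hk).symm hzq (by omega) (by omega)
    exact .inl (this ▸ hk.symm)
  by_cases h2 : q ∈ A₂
  · have hm := hmax q h2
    omega
  refine .inr ⟨h1, h2, hzq, fun y hy => ?_⟩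
  have := h.dist_lt_of_deep hG hmax h1 h2 (by omega) hy
  exact parent_unique hG (r := r) hy.symm hzq this (by omega)

open scoped Classical in
/-- A tree packed by a single star has diameter four, and its initial labelling gives `S` to the
edges of the star. -/
theorem IsStarPacking.hasFamilyLabelling_of_unique [Finite V] (h : IsStarPacking G D A₁ A₂)
    (hG : G.IsTree) {r : V} (hr : r ∈ A₂) (huniq : ∀ c ∈ A₂, c = r) :
    HasFamilyLabelling G D := by
  have hmax : ∀ c' ∈ A₂, G.dist r c' ≤ G.dist r r := fun c' hc' => by rw [huniq c' hc']
  have hr1 : r ∉ A₁ := fun h' => h.not_mem_both h' hr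
  have hstar : ∀ {w}, w ∈ A₁ → D.Adj r w := by
    intro w hw
    obtain ⟨k, hk, -⟩ := h.leaf hw
    exact huniq k (h.mem_right_of_mem_left hw hk) ▸ hk.symm
  have hchild : ∀ {a b}, G.Adj a b → ¬ D.Adj a b →
      IsPendant G A₁ A₂ a b ∨ IsPendant G A₁ A₂ b a := by
    intro a b hab hD
    have h0 : G.dist r r = 0 := by simp
    rcases hG.dist_eq_dist_add_one_of_adj r hab with h' | h'
    · exact .inr ((h.adj_or_isPendant hG hmax hab.symm h' (by omega)).resolve_left
        fun h'' => hD h''.symm)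
    · exact .inl ((h.adj_or_isPendant hG hmax hab h' (by omega)).resolve_left hD)
  obtain ⟨w, w', hne, hw, hw'⟩ := h.centre hr
  have hwA := h.mem_left_of_mem_right hr hw
  have hwA' := h.mem_left_of_mem_right hr hw'
  have hN : ∀ e, IsNonLeafEdge G e ↔ ∃ w ∈ A₁, e = s(r, w) := by
    intro e
    constructor
    · induction e with
      | _ a b =>
        rintro ⟨hab, hl⟩
        by_cases hD : D.Adj a b
        · rcases h.adj_cases hD with ⟨ha, hb⟩ | ⟨ha, hb⟩
          · exact ⟨a, ha, by rw [huniq b hb, Sym2.eq_swap]⟩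
          · exact ⟨b, hb, by rw [huniq a ha]⟩
        · exfalso
          rcases hchild hab hD with h' | h'
          · exact hl ⟨b, by simp, a, h'.2.2.1.symm, h'.2.2.2⟩
          · exact hl ⟨a, by simp, b, h'.2.2.1.symm, h'.2.2.2⟩
    · rintro ⟨y, hy, rfl⟩
      refine ⟨h.le (hstar hy), ?_⟩
      rintro ⟨z, hz, hl⟩
      rcases Sym2.mem_iff.1 hz with rfl | rfl
      · exact hne (hl.unique (h.le hw) (h.le hw'))
      · obtain ⟨x, h1, h2, h3, -⟩ := h.priv hy
        exact h2 (hl.unique (h.le (hstar hy)).symm h3 ▸ hr)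
  have hND : ∀ {a b}, IsNonLeafEdge G s(a, b) ↔ D.Adj a b := by
    intro a b
    rw [hN]
    constructor
    · rintro ⟨y, hy, h'⟩
      rcases Sym2.eq_iff.1 h' with ⟨rfl, rfl⟩ | ⟨rfl, rfl⟩
      exacts [hstar hy, (hstar hy).symm]
    · intro hD
      rcases h.adj_cases hD with ⟨ha, hb⟩ | ⟨ha, hb⟩
      · exact ⟨a, ha, by rw [huniq b hb, Sym2.eq_swap]⟩
      · exact ⟨b, hb, by rw [huniq a ha]⟩
  let T : LGraph V :=
    { lab := fun a b => if D.Adj a b then some S else if G.Adj a b then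
        (if a = r ∨ b = r then some L2 else some L1) else none
      symm := fun a b => by simp only [D.adj_comm a b, G.adj_comm a b, or_comm]
      irrefl := fun a => by simp }
  have hlab : ∀ a b, T.lab a b = if D.Adj a b then some S else if G.Adj a b then
        (if a = r ∨ b = r then some L2 else some L1) else none := fun a b => rfl
  have hTG : T.graph = G := by
    ext a b
    rw [adj_iff, hlab]
    by_cases h1 : D.Adj a b
    · simp [h1, h.le h1]
    · by_cases h2 : G.Adj a b
      · by_cases h3 : a = r ∨ b = r <;> simp [h1, h2, h3]
      · simp [h1, h2]
  have hTD : T.sGraph = D := by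
    ext a b
    rw [sGraph_adj, hlab]
    by_cases h1 : D.Adj a b
    · simp [h1]
    · by_cases h2 : G.Adj a b
      · by_cases h3 : a = r ∨ b = r <;> simp [h1, h2, h3]
      · simp [h1, h2]
  refine ⟨T, hTG, hTD, FamilyTt.initial T (hTG ▸ hG) ?_ ?_⟩
  · rw [hTG]
    have hd2 : ∀ z, G.dist r z ≤ 2 := by
      have hd1 : ∀ y, y ∈ A₁ ∨ y ∈ A₂ → G.dist r y ≤ 1 := by
        rintro y (hy | hy)
        · rw [SimpleGraph.dist_eq_one_iff_adj.2 (h.le (hstar hy))]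
        · rw [huniq y hy]; simp
      intro z
      by_cases hz : z = r
      · rw [hz]; simp
      obtain ⟨y, hzy, hd⟩ := exists_parent hG hz
      by_cases hz' : z ∈ A₁ ∨ z ∈ A₂
      · exact (hd1 z hz').trans (by norm_num)
      · have hy : y ∈ A₁ ∨ y ∈ A₂ := by
          rcases h.cover hzy with h' | h' | h' | h' <;> tauto
        have := hd1 y hy
        omega
    apply le_antisymm
    · have : Nonempty V := ⟨r⟩
      obtain ⟨a, b, hab⟩ := G.exists_dist_eq_diam
      rw [← hab]
      have h1 := hG.connected.dist_triangle (u := a) (v := r) (w := b)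
      have h2 := hd2 a
      have h3 := hd2 b
      rw [SimpleGraph.dist_comm] at h2
      omega
    · obtain ⟨x, h1, h2, h3, h4⟩ := h.priv hwA
      obtain ⟨x', h1', h2', h3', h4'⟩ := h.priv hwA'
      have hxx : x ≠ x' := by rintro rfl; exact hne (h4' w hwA h3)
      have hxw' : x ≠ w' := by rintro rfl; exact h1 hwA'
      have hwx' : w ≠ x' := by rintro rfl; exact h1' hwA
      have hxr : x ≠ r := by rintro rfl; exact h2 hr
      have hrx' : r ≠ x' := by rintro rfl; exact h2' hr
      have hd := dist_eq_length_of_isPath hG (.cons h3.symm (.cons (h.le hw).symm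
        (.cons (h.le hw') (.cons h3' .nil))))
        (by simp [h3.ne.symm, (h.le hw).ne.symm, (h.le hw').ne, h3'.ne, hxx, hxw', hwx', hxr,
          hrx', hne])
      have hdiam := SimpleGraph.dist_le_diam (G := G) (u := x) (v := x')
        (by have : Nonempty V := ⟨r⟩
            exact SimpleGraph.connected_iff_ediam_ne_top.1 hG.connected)
      rw [hd] at hdiam
      exact hdiam
  · intro a b hab
    rw [hTG] at hab ⊢
    have htwo := fun hl => exists_two_nonLeafEdges_iff hN ⟨w, hwA, w', hwA', hne⟩
      (fun a ha b hb => h.indep ha hb) hab hl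
    refine ⟨fun hn => by simp [hlab, hND.1 hn], fun hl => ?_⟩
    have hn : ¬ IsNonLeafEdge G s(a, b) := fun hn => hn.2 hl.2
    have hD : ¬ D.Adj a b := fun h' => hn (hND.2 h')
    rw [htwo hn, hlab, if_neg hD, if_pos hab]
    exact ⟨fun h' => if_pos h', fun h' => if_neg h'⟩

end Deep

/-! ### Attached paths in coordinates -/

section Coordinates

variable {V : Type u}

theorem path_nil_lab (i j : Fin 1) : (path []).lab i j = none := by
  revert i j; decide

theorem path_one_lab (i j : Fin 2) : (path [L1]).lab i j =
    (![![none, some L1], ![some L1, none]] : Fin 2 → Fin 2 → Option EdgeLabel) i j := by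
  revert i j; decide

theorem path_three_lab (i j : Fin 4) : (path [S, S, L1]).lab i j =
    (![![none, some S, none, none], ![some S, none, some S, none],
      ![none, some S, none, some L1], ![none, none, some L1, none]] :
        Fin 4 → Fin 4 → Option EdgeLabel) i j := by
  revert i j; decide

theorem path_four_lab (i j : Fin 5) : (path [L1, S, S, L1]).lab i j =
    (![![none, some L1, none, none, none], ![some L1, none, some S, none, none],
      ![none, some S, none, some S, none], ![none, none, some S, none, some L1],
      ![none, none, none, some L1, none]] : Fin 5 → Fin 5 → Option EdgeLabel) i j := by
  revert i j; decide

theorem exists_fin_four {Q : Fin 4 → Prop} : (∃ j, Q j) ↔ Q 0 ∨ Q 1 ∨ Q 2 ∨ Q 3 := by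
  simp [Fin.exists_fin_succ]

theorem exists_fin_five {Q : Fin 5 → Prop} : (∃ j, Q j) ↔ Q 0 ∨ Q 1 ∨ Q 2 ∨ Q 3 ∨ Q 4 := by
  simp [Fin.exists_fin_succ]

theorem mem_range_four {a b c d y : V} : y ∈ Set.range ![a, b, c, d] ↔
    y = a ∨ y = b ∨ y = c ∨ y = d := by
  rw [Set.mem_range, exists_fin_four]
  simp [eq_comm]

theorem mem_range_five {a b c d e y : V} : y ∈ Set.range ![a, b, c, d, e] ↔
    y = a ∨ y = b ∨ y = c ∨ y = d ∨ y = e := by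
  rw [Set.mem_range, exists_fin_five]
  simp [eq_comm]

theorem injective_four {a b c d : V} (h : [a, b, c, d].Nodup) :
    Function.Injective ![a, b, c, d] := by
  rw [← List.nodup_ofFn]
  simpa using h

theorem injective_five {a b c d e : V} (h : [a, b, c, d, e].Nodup) :
    Function.Injective ![a, b, c, d, e] := by
  rw [← List.nodup_ofFn]
  simpa using h

end Coordinates

/-! ### Building packed trees by the operations -/

/-- The converse of `IsLabelledPacking.exists_private_ne`: the side condition of the third operation
holds at `v` if every leaf adjacent to `v` has a private neighbour other than `v`. -/
theorem IsLabelledPacking.o3Condition {V : Type u} {T : LGraph V} {A₁ A₂ : Set V}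
    (h : IsLabelledPacking T A₁ A₂) {v : V} (hv₁ : v ∉ A₁) (hv₂ : v ∉ A₂)
    (hpriv : ∀ w ∈ A₁, T.graph.Adj w v → ∃ x, x ≠ v ∧ x ∉ A₁ ∧ x ∉ A₂ ∧ T.graph.Adj w x ∧
      ∀ w' ∈ A₁, T.graph.Adj w' x → w' = w) : T.O3Condition v := by
  intro w hvw
  have hadj : T.graph.Adj v w := by rw [adj_iff, hvw]; simp
  have hw : w ∈ A₁ := by
    rcases h.cover hadj with h' | h' | h' | h'
    · exact (hv₁ h').elim
    · exact (hv₂ h').elim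
    · exact h'
    · have := h.lab₂ h' hv₁ hv₂ hadj.symm
      rw [T.symm, hvw] at this
      simp at this
  obtain ⟨x, hxv, hx₁, hx₂, hwx, hu⟩ := hpriv w hw hadj.symm
  by_cases hl : ∃ y, y ≠ w ∧ T.graph.Adj x y
  · right
    obtain ⟨y, hyw, hxy⟩ := hl
    have hall : ∀ z, T.graph.Adj x z → z ≠ w → T.lab x z = some L2 := by
      intro z hz hzw
      rw [T.symm]
      refine h.lab₂ ?_ hx₁ hx₂ hz.symm
      rcases h.cover hz with h' | h' | h' | h'
      exacts [(hx₁ h').elim, (hx₂ h').elim, (hzw (hu z h' hz.symm)).elim, h']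
    refine ⟨x, y, ?_, h.lab₁ hw hx₁ hx₂ hwx, hall y hxy hyw, hall⟩
    have hvy : v ≠ y := by
      rintro rfl
      rcases h.cover hxy with h' | h' | h' | h'
      exacts [hx₁ h', hx₂ h', hv₁ h', hv₂ h']
    simp [hadj.ne, hxv.symm, hvy, hwx.ne, hyw.symm, hxy.ne]
  · left
    push Not at hl
    refine ⟨s(w, x), ⟨hwx, x, by simp, w, hwx.symm, fun y hy => ?_⟩, ?_, w, by simp, by simp⟩
    · by_contra hyw
      exact hl y hyw hy
    · intro e
      have := hadj.ne
      grind

section Build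

variable {V : Type u} {G D : SimpleGraph V} {A₁ A₂ : Set V}

/-- Every proper subtree that still contains a star and on which the star packing restricts to a
star packing has a family labelling. -/
def SubtreesLabelled (G D : SimpleGraph V) (A₁ A₂ : Set V) : Prop :=
  ∀ s : Set V, s ≠ Set.univ → (G.induce s).IsTree →
    IsStarPacking (G.induce s) (D.induce s) {x | (x : V) ∈ A₁} {x | (x : V) ∈ A₂} →
    (∃ c ∈ s, c ∈ A₂) → HasFamilyLabelling (G.induce s) (D.induce s)

theorem IsPendant.adj_iff {w x y : V} (h : IsPendant G A₁ A₂ w x) : G.Adj x y ↔ y = w :=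
  ⟨h.2.2.2 y, by rintro rfl; exact h.2.2.1.symm⟩

theorem IsPendant.not_adj {w x y : V} (h : IsStarPacking G D A₁ A₂)
    (hx : IsPendant G A₁ A₂ w x) : ¬ D.Adj x y := h.not_adj_of_uncovered hx.1 hx.2.1

/-- A pendant vertex at a centre is removed by undoing the first operation. -/
theorem HasFamilyLabelling.of_pendant_centre (hG : G.IsTree) (h : IsStarPacking G D A₁ A₂)
    (IH : SubtreesLabelled G D A₁ A₂) {c x : V} (hc : c ∈ A₂) (hx : IsPendant G A₁ A₂ c x) :
    HasFamilyLabelling G D := by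
  have hcx : c ≠ x := hx.2.2.1.ne
  refine .of_cut (W := Fin 1) hG h IH (path []) 0 (fun _ : Fin 1 => x) (Function.injective_of_subsingleton _)
    (v := c) (by simpa using hcx) L2 ?_ ?_ (by simp) (fun h' => (h.not_mem_both h' hc).elim)
    ⟨c, hc, by simpa using hcx⟩ ?_
  · intro i y
    obtain rfl := Subsingleton.elim i 0
    simp [path_nil_lab, hx.adj_iff]
  · intro i y
    simp [path_nil_lab, hx.not_adj h]
  · intro T hTG hT hgood
    refine .op1_A2 T _ hT ?_
    rw [hgood.classA2_eq]
    exact hc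

/-- One of two pendant vertices at a leaf of a star is removed by undoing the first operation. -/
theorem HasFamilyLabelling.of_two_pendants (hG : G.IsTree) (h : IsStarPacking G D A₁ A₂)
    (IH : SubtreesLabelled G D A₁ A₂) {w x x' : V} (hw : w ∈ A₁) (hx : IsPendant G A₁ A₂ w x)
    (hx' : IsPendant G A₁ A₂ w x') (hne : x ≠ x') : HasFamilyLabelling G D := by
  have hwx : w ≠ x := hx.2.2.1.ne
  obtain ⟨c, hc, -⟩ := h.leaf hw
  have hcA := h.mem_right_of_mem_left hw hc
  have hcx : c ≠ x := by rintro rfl; exact hx.2.1 hcA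
  refine .of_cut (W := Fin 1) hG h IH (path []) 0 (fun _ : Fin 1 => x) (Function.injective_of_subsingleton _)
    (v := w) (by simpa using hwx) L1 ?_ ?_ (by simp) (fun _ => ⟨x', by simpa using hne.symm,
      hx'.1, hx'.2.1, hx'.2.2.1, fun w' _ h' => hx'.2.2.2 w' h'.symm⟩)
    ⟨c, hcA, by simpa using hcx⟩ ?_
  · intro i y
    obtain rfl := Subsingleton.elim i 0
    simp [path_nil_lab, hx.adj_iff]
  · intro i y
    simp [path_nil_lab, hx.not_adj h]
  · intro T hTG hT hgood
    refine .op1_A1 T _ hT ?_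
    rw [hgood.classA1_eq]
    exact hw

/-- A leaf whose only other neighbour is a pendant vertex is removed by undoing the second operation
if its star has at least two other leaves. -/
theorem HasFamilyLabelling.of_three_leaves (hG : G.IsTree) (h : IsStarPacking G D A₁ A₂)
    (IH : SubtreesLabelled G D A₁ A₂) {c w x w' w'' : V} (hc : c ∈ A₂) (hcw : D.Adj c w)
    (hw : ∀ y, G.Adj w y ↔ y = c ∨ y = x) (hx : IsPendant G A₁ A₂ w x) (hcw' : D.Adj c w')
    (hcw'' : D.Adj c w'') (h1 : w' ≠ w) (h2 : w'' ≠ w) (h3 : w' ≠ w'') :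
    HasFamilyLabelling G D := by
  have hwA := h.mem_left_of_mem_right hc hcw
  have hwx : w ≠ x := hx.2.2.1.ne
  have hcx : c ≠ x := by rintro rfl; exact hx.2.1 hc
  have hnx : ∀ y, D.Adj c y → y ≠ x := by
    rintro y hy rfl; exact hx.1 (h.mem_left_of_mem_right hc hy)
  have hDw : ∀ y, D.Adj w y ↔ y = c :=
    fun y => ⟨fun hy => (h.leaf hwA).unique hy hcw.symm, by rintro rfl; exact hcw.symm⟩
  have hrange : ∀ y, y ∈ Set.range ![w, x] ↔ y = w ∨ y = x := by simp [eq_comm, or_comm]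
  have hinj : Function.Injective ![w, x] := by
    intro i j
    fin_cases i <;> fin_cases j <;> simp [hwx, hwx.symm]
  have hcr : c ∉ Set.range ![w, x] := by
    rw [hrange]; simp [hcw.ne, hcx]
  refine .of_cut (W := Fin 2) hG h IH (path [L1]) 0 (![w, x] : Fin 2 → V) hinj hcr S ?_ ?_
    (fun _ => ⟨hc, w', w'', h3, hcw', hcw'', ?_, ?_⟩) (fun h' => (h.not_mem_both h' hc).elim)
    ⟨c, hc, hcr⟩ ?_
  · intro i y
    simp only [Fin.exists_fin_two, path_one_lab]
    fin_cases i <;> simp [hw, hx.adj_iff, or_comm]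
  · intro i y
    simp only [Fin.exists_fin_two, path_one_lab]
    fin_cases i <;> simp [hDw, hx.not_adj h]
  · rw [hrange]; simp [h1, hnx w' hcw']
  · rw [hrange]; simp [h2, hnx w'' hcw'']
  · intro T hTG hT hgood
    refine .op2 T _ hT ?_
    rw [hgood.classA2_eq]
    exact hc

/-- If only `c` and pendant vertices are adjacent to a leaf `w` at `c`, then, unless an operation can
be undone, there is exactly one pendant vertex at `w`. -/
theorem IsStarPacking.exists_unique_pendant (h : IsStarPacking G D A₁ A₂) (hG : G.IsTree)
    (IH : SubtreesLabelled G D A₁ A₂) (hno : ¬ HasFamilyLabelling G D) {c w : V} (hc : c ∈ A₂)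
    (hcw : D.Adj c w) (hw : ∀ y, G.Adj w y → y = c ∨ IsPendant G A₁ A₂ w y) :
    ∃ x, IsPendant G A₁ A₂ w x ∧ ∀ y, G.Adj w y ↔ y = c ∨ y = x := by
  have hwA := h.mem_left_of_mem_right hc hcw
  obtain ⟨x, hx₁, hx₂, hwx, -⟩ := h.priv hwA
  have hx : IsPendant G A₁ A₂ w x := by
    rcases hw x hwx with rfl | h'
    exacts [(hx₂ hc).elim, h']
  refine ⟨x, hx, fun y => ⟨fun hy => ?_, ?_⟩⟩
  · rcases hw y hy with h' | h'
    · exact .inl h'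
    · right
      by_contra hne
      exact hno (.of_two_pendants hG h IH hwA h' hx hne)
  · rintro (rfl | rfl)
    exacts [(h.le hcw).symm, hwx]

/-- A star whose only connection to the rest of the tree, apart from pendant vertices, is an edge at
its centre `c`, is removed by undoing the fifth operation. -/
theorem HasFamilyLabelling.of_centre (hG : G.IsTree) (h : IsStarPacking G D A₁ A₂)
    (IH : SubtreesLabelled G D A₁ A₂) {c v : V} (hc : c ∈ A₂) (hcv : G.Adj c v)
    (hDcv : ¬ D.Adj c v) (hcn : ∀ y, G.Adj c y → y = v ∨ D.Adj c y ∨ IsPendant G A₁ A₂ c y)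
    (hwn : ∀ w, D.Adj c w → ∀ y, G.Adj w y → y = c ∨ IsPendant G A₁ A₂ w y)
    (hc0 : ∃ c' ∈ A₂, c' ≠ c) : HasFamilyLabelling G D := by
  by_contra hno
  have hleaf := fun {w} (hcw : D.Adj c w) => h.exists_unique_pendant hG IH hno hc hcw (hwn w hcw)
  obtain ⟨w, w', hne, hcw, hcw'⟩ := h.centre hc
  obtain ⟨x, hx, hw⟩ := hleaf hcw
  obtain ⟨x', hx', hw'⟩ := hleaf hcw'
  have hDc : ∀ y, D.Adj c y ↔ y = w ∨ y = w' := by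
    refine fun y => ⟨fun hy => ?_, by rintro (rfl | rfl) <;> assumption⟩
    by_contra hcon
    push Not at hcon
    obtain ⟨z, hz, hyz⟩ := hleaf hy
    exact hno (.of_three_leaves hG h IH hc hy hyz hz hcw hcw' hcon.1.symm hcon.2.symm hne)
  have hGc : ∀ y, G.Adj c y ↔ y = w ∨ y = w' ∨ y = v := by
    refine fun y => ⟨fun hy => ?_, ?_⟩
    · rcases hcn y hy with h' | h' | h'
      · exact .inr (.inr h')
      · rcases (hDc y).1 h' with h' | h' <;> simp [h']
      · exact (hno (.of_pendant_centre hG h IH hc h')).elim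
    · rintro (rfl | rfl | rfl)
      exacts [h.le hcw, h.le hcw', hcv]
  have hwA := h.mem_left_of_mem_right hc hcw
  have hwA' := h.mem_left_of_mem_right hc hcw'
  have hD1 : ∀ y, D.Adj w y ↔ y = c :=
    fun y => ⟨fun hy => (h.leaf hwA).unique hy hcw.symm, by rintro rfl; exact hcw.symm⟩
  have hD2 : ∀ y, D.Adj w' y ↔ y = c :=
    fun y => ⟨fun hy => (h.leaf hwA').unique hy hcw'.symm, by rintro rfl; exact hcw'.symm⟩
  have hxc : x ≠ c := by rintro rfl; exact hx.2.1 hc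
  have hxc' : x' ≠ c := by rintro rfl; exact hx'.2.1 hc
  have hxw : x ≠ w' := by rintro rfl; exact hx.1 hwA'
  have hxw' : x' ≠ w := by rintro rfl; exact hx'.1 hwA
  have hxx : x ≠ x' := by
    rintro rfl; exact hne (hx'.2.2.2 w hx.2.2.1.symm)
  have hvw : v ≠ w := by rintro rfl; exact hDcv hcw
  have hvw' : v ≠ w' := by rintro rfl; exact hDcv hcw'
  have hvx : v ≠ x := by rintro rfl; exact hcw.ne (hx.2.2.2 c hcv.symm)
  have hvx' : v ≠ x' := by rintro rfl; exact hcw'.ne (hx'.2.2.2 c hcv.symm)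
  have hinj : Function.Injective ![x, w, c, w', x'] := injective_five (by
    simp [hx.2.2.1.ne.symm, hxc, hxw, hxx, hcw.ne.symm, hne, hxw'.symm, hcw'.ne, hxc'.symm,
      hx'.2.2.1.ne])
  have hv : v ∉ Set.range ![x, w, c, w', x'] := by
    rw [mem_range_five]
    simp [hvx, hvw, hvw', hvx', hcv.ne.symm]
  refine hno (.of_cut (W := Fin 5) hG h IH (path [L1, S, S, L1]) 2 (![x, w, c, w', x'] : Fin 5 → V) hinj hv L2
    ?_ ?_ (by simp) ?_ ?_ (fun T _ hT _ => .op5 T _ hT))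
  · intro i y
    simp only [exists_fin_five, path_four_lab]
    fin_cases i <;> simp [hx.adj_iff, hx'.adj_iff, hw, hw', hGc, or_comm]
    tauto
  · intro i y
    simp only [exists_fin_five, path_four_lab]
    fin_cases i <;> simp [hx.not_adj h, hx'.not_adj h, hD1, hD2, hDc]
  · intro hvA
    obtain ⟨z, hz₁, hz₂, hvz, hz⟩ := h.priv hvA
    refine ⟨z, ?_, hz₁, hz₂, hvz, hz⟩
    rw [mem_range_five]
    rintro (rfl | rfl | rfl | rfl | rfl)
    · exact hvw (hx.2.2.2 v hvz.symm)
    · exact hz₁ hwA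
    · exact hz₂ hc
    · exact hz₁ hwA'
    · exact hvw' (hx'.2.2.2 v hvz.symm)
  · obtain ⟨c', hc', hne'⟩ := hc0
    refine ⟨c', hc', ?_⟩
    rw [mem_range_five]
    rintro (rfl | rfl | rfl | rfl | rfl)
    exacts [hx.2.1 hc', h.not_mem_both hwA hc', hne' rfl, h.not_mem_both hwA' hc', hx'.2.1 hc']

/-- A star whose only connection to the rest of the tree, apart from pendant vertices, is an edge at
its leaf `w`, is removed by undoing the third operation if there is a pendant vertex at `w`, and the
fourth operation otherwise. -/
theorem HasFamilyLabelling.of_leaf (hG : G.IsTree) (h : IsStarPacking G D A₁ A₂)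
    (IH : SubtreesLabelled G D A₁ A₂) {c w v : V} (hc : c ∈ A₂) (hcw : D.Adj c w)
    (hwv : G.Adj w v) (hvc : v ≠ c) (hcn : ∀ y, G.Adj c y → D.Adj c y ∨ IsPendant G A₁ A₂ c y)
    (hwn : ∀ w', D.Adj c w' → w' ≠ w → ∀ y, G.Adj w' y → y = c ∨ IsPendant G A₁ A₂ w' y)
    (hw : ∀ y, G.Adj w y → y = c ∨ y = v ∨ IsPendant G A₁ A₂ w y)
    (hvp : ¬ IsPendant G A₁ A₂ w v)
    (hc0 : ∃ c' ∈ A₂, c' ≠ c) : HasFamilyLabelling G D := by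
  by_contra hno
  have hleaf := fun {w'} (hcw' : D.Adj c w') (hne : w' ≠ w) =>
    h.exists_unique_pendant hG IH hno hc hcw' (hwn w' hcw' hne)
  obtain ⟨w', hcw', hne⟩ : ∃ w', D.Adj c w' ∧ w' ≠ w := by
    obtain ⟨a, b, hab, ha, hb⟩ := h.centre hc
    by_cases haw : a = w
    · exact ⟨b, hb, fun e => hab (haw.trans e.symm)⟩
    · exact ⟨a, ha, haw⟩
  obtain ⟨x', hx', hw'⟩ := hleaf hcw' hne
  have hDc : ∀ y, D.Adj c y ↔ y = w ∨ y = w' := by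
    refine fun y => ⟨fun hy => ?_, by rintro (rfl | rfl) <;> assumption⟩
    by_contra hcon
    push Not at hcon
    obtain ⟨z, hz, hyz⟩ := hleaf hy hcon.1
    exact hno (.of_three_leaves hG h IH hc hy hyz hz hcw hcw' hcon.1.symm hcon.2.symm hne.symm)
  have hGc : ∀ y, G.Adj c y ↔ y = w ∨ y = w' := by
    refine fun y => ⟨fun hy => ?_, fun hy => h.le ((hDc y).2 hy)⟩
    rcases hcn y hy with h' | h'
    · exact (hDc y).1 h'
    · exact (hno (.of_pendant_centre hG h IH hc h')).elim
  have hwA := h.mem_left_of_mem_right hc hcw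
  have hwA' := h.mem_left_of_mem_right hc hcw'
  have hD1 : ∀ y, D.Adj w y ↔ y = c :=
    fun y => ⟨fun hy => (h.leaf hwA).unique hy hcw.symm, by rintro rfl; exact hcw.symm⟩
  have hD2 : ∀ y, D.Adj w' y ↔ y = c :=
    fun y => ⟨fun hy => (h.leaf hwA').unique hy hcw'.symm, by rintro rfl; exact hcw'.symm⟩
  have hxc' : x' ≠ c := by rintro rfl; exact hx'.2.1 hc
  have hxw' : x' ≠ w := by rintro rfl; exact hx'.1 hwA
  have hvA : v ∉ A₁ := fun h' => h.indep hwA h' hwv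
  have hvw' : v ≠ w' := by rintro rfl; exact hvA hwA'
  have hvx' : v ≠ x' := by rintro rfl; exact hne (hx'.2.2.2 w hwv.symm).symm
  by_cases hp : ∃ x, IsPendant G A₁ A₂ w x
  · obtain ⟨x, hx⟩ := hp
    have hGw : ∀ y, G.Adj w y ↔ y = x ∨ y = c ∨ y = v := by
      refine fun y => ⟨fun hy => ?_, ?_⟩
      · rcases hw y hy with h' | h' | h'
        · exact .inr (.inl h')
        · exact .inr (.inr h')
        · left
          by_contra hyx
          exact hno (.of_two_pendants hG h IH hwA h' hx hyx)
      · rintro (rfl | rfl | rfl)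
        exacts [hx.2.2.1, (h.le hcw).symm, hwv]
    have hxc : x ≠ c := by rintro rfl; exact hx.2.1 hc
    have hxw : x ≠ w' := by rintro rfl; exact hx.1 hwA'
    have hxx : x ≠ x' := by
      rintro rfl; exact hne (hx'.2.2.2 w hx.2.2.1.symm).symm
    have hvx : v ≠ x := by rintro rfl; exact hvp hx
    have hinj : Function.Injective ![x, w, c, w', x'] := injective_five (by
      simp [hx.2.2.1.ne.symm, hxc, hxw, hxx, hcw.ne.symm, hne.symm, hxw'.symm, hcw'.ne,
        hxc'.symm, hx'.2.2.1.ne])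
    have hv : v ∉ Set.range ![x, w, c, w', x'] := by
      rw [mem_range_five]
      simp [hvx, hwv.ne.symm, hvc, hvw', hvx']
    refine hno (.of_cut (W := Fin 5) hG h IH (path [L1, S, S, L1]) 1 (![x, w, c, w', x'] : Fin 5 → V) hinj hv
      L1 ?_ ?_ (by simp) (fun h' => (hvA h').elim) ?_ ?_)
    · intro i y
      simp only [exists_fin_five, path_four_lab]
      fin_cases i <;> simp [hx.adj_iff, hx'.adj_iff, hGw, hw', hGc, or_assoc]
    · intro i y
      simp only [exists_fin_five, path_four_lab]
      fin_cases i <;> simp [hx.not_adj h, hx'.not_adj h, hD1, hD2, hDc]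
    · obtain ⟨c', hc', hne'⟩ := hc0
      refine ⟨c', hc', ?_⟩
      rw [mem_range_five]
      rintro (rfl | rfl | rfl | rfl | rfl)
      exacts [hx.2.1 hc', h.not_mem_both hwA hc', hne' rfl, h.not_mem_both hwA' hc', hx'.2.1 hc']
    · intro T hTG hT hgood
      refine .op3 T _ hT (by rw [hgood.classA1_eq]; exact hvA) fun hC => ?_
      rw [classC, hgood.classA1_eq, hgood.classA2_eq] at hC
      have hvA₂ : v ∉ A₂ := fun h' => hC (.inl (.inr h'))
      refine hgood.o3Condition hvA hvA₂ ?_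
      rintro ⟨a, ha⟩ haA -
      obtain ⟨z, hz₁, hz₂, haz, hz⟩ := h.priv (show a ∈ A₁ from haA)
      rw [Set.mem_compl_iff, mem_range_five] at ha
      push Not at ha
      have hzr : z ∈ (Set.range ![x, w, c, w', x'])ᶜ := by
        rw [Set.mem_compl_iff, mem_range_five]
        rintro (rfl | rfl | rfl | rfl | rfl)
        · exact ha.2.1 (hx.2.2.2 a haz.symm)
        · exact hz₁ hwA
        · exact hz₂ hc
        · exact hz₁ hwA'
        · exact ha.2.2.2.1 (hx'.2.2.2 a haz.symm)
      refine ⟨⟨z, hzr⟩, ?_, hz₁, hz₂, by rw [hTG]; exact haz, ?_⟩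
      · intro e
        have e' : z = v := congrArg Subtype.val e
        subst e'
        exact ha.2.1 (hz w hwA hwv).symm
      · intro b hb hbz
        rw [hTG] at hbz
        exact Subtype.ext (hz b hb hbz)
  · have hGw : ∀ y, G.Adj w y ↔ y = c ∨ y = v := by
      refine fun y => ⟨fun hy => ?_, ?_⟩
      · rcases hw y hy with h' | h' | h'
        exacts [.inl h', .inr h', (hp ⟨y, h'⟩).elim]
      · rintro (rfl | rfl)
        exacts [(h.le hcw).symm, hwv]
    -- the private neighbour of `w` can only be `v`
    obtain ⟨hvA₂, hvu⟩ : v ∉ A₂ ∧ ∀ a ∈ A₁, G.Adj a v → a = w := by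
      obtain ⟨z, -, hz₂, hwz, hz⟩ := h.priv hwA
      rcases (hGw z).1 hwz with rfl | rfl
      exacts [(hz₂ hc).elim, ⟨hz₂, hz⟩]
    have hinj : Function.Injective ![w, c, w', x'] := injective_four (by
      simp [hcw.ne.symm, hne.symm, hxw'.symm, hcw'.ne, hxc'.symm, hx'.2.2.1.ne])
    have hv : v ∉ Set.range ![w, c, w', x'] := by
      rw [mem_range_four]
      simp [hwv.ne.symm, hvc, hvw', hvx']
    refine hno (.of_cut (W := Fin 4) hG h IH (path [S, S, L1]) 0 (![w, c, w', x'] : Fin 4 → V) hinj hv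
      L1 ?_ ?_ (by simp) (fun h' => (hvA h').elim) ?_ ?_)
    · intro i y
      simp only [exists_fin_four, path_three_lab]
      fin_cases i <;> simp [hx'.adj_iff, hGw, hw', hGc]
    · intro i y
      simp only [exists_fin_four, path_three_lab]
      fin_cases i <;> simp [hx'.not_adj h, hD1, hD2, hDc]
    · obtain ⟨c', hc', hne'⟩ := hc0
      refine ⟨c', hc', ?_⟩
      rw [mem_range_four]
      rintro (rfl | rfl | rfl | rfl)
      exacts [h.not_mem_both hwA hc', hne' rfl, h.not_mem_both hwA' hc', hx'.2.1 hc']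
    · intro T hTG hT hgood
      refine .op4 T _ hT (hgood.mem_classB_of hvA hvA₂ ?_)
      rintro ⟨a, ha⟩ haA hav
      rw [hTG] at hav
      rw [Set.mem_compl_iff, mem_range_four] at ha
      exact ha (.inl (hvu a haA hav))

/-- Every packed tree with at least one star has a family labelling: root it at a centre and remove
a deepest star, or a part of one. -/
theorem IsStarPacking.hasFamilyLabelling [Finite V] (hG : G.IsTree) (h : IsStarPacking G D A₁ A₂)
    (hne : A₂.Nonempty) : HasFamilyLabelling G D := by
  induction hn : Nat.card V using Nat.strong_induction_on generalizing V with
  | _ n ih =>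
  have IH : SubtreesLabelled G D A₁ A₂ := by
    rintro s hs hsG hsP ⟨c, hcs, hc⟩
    refine ih (Nat.card s) ?_ hsG hsP ⟨⟨c, hcs⟩, hc⟩ rfl
    rw [← hn, Nat.card_coe_set_eq]
    exact Set.ncard_lt_card hs
  obtain ⟨r, hr⟩ := hne
  by_cases huniq : ∀ c ∈ A₂, c = r
  · exact h.hasFamilyLabelling_of_unique hG hr huniq
  push Not at huniq
  obtain ⟨c₀, hc₀, hc₀r⟩ := huniq
  obtain ⟨c₁, hc₁, hmax₁⟩ := Set.exists_max_image A₂ (G.dist r) (Set.toFinite _) ⟨r, hr⟩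
  have hroot : ∀ c, (∀ c' ∈ A₂, G.dist r c' ≤ G.dist r c) → c ≠ r := by
    rintro c hc rfl
    have h1 := hc c₀ hc₀
    have h2 := hG.connected.pos_dist_of_ne hc₀r.symm
    rw [SimpleGraph.dist_self] at h1
    omega
  have hstep : ∀ {a b}, G.Adj a b → G.dist r a = G.dist r b + 1 ∨ G.dist r b = G.dist r a + 1 :=
    fun hab => hG.dist_eq_dist_add_one_of_adj r hab
  -- neighbours of a child `w` of a deepest centre `c` in the star of `c`
  have hbelow : ∀ {c w}, c ∈ A₂ → (∀ c' ∈ A₂, G.dist r c' ≤ G.dist r c) → D.Adj c w →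
      G.dist r w = G.dist r c + 1 → ∀ y, G.Adj w y → y = c ∨ IsPendant G A₁ A₂ w y := by
    intro c w hc hmax hcw hd y hy
    rcases hstep hy with h' | h'
    · exact .inl (parent_unique hG (r := r) hy.symm (h.le hcw) (by omega) (by omega))
    · rcases h.adj_or_isPendant hG hmax hy h' (by omega) with h'' | h''
      · exact .inl ((h.leaf (h.mem_left_of_mem_right hc hcw)).unique h'' hcw.symm)
      · exact .inr h''
  -- a deepest centre not joined to its parent by a star edge is preferred; if there is none, then
  -- the parent of every deepest centre is a leaf of its star
  by_cases hA : ∃ c ∈ A₂, (∀ c' ∈ A₂, G.dist r c' ≤ G.dist r c) ∧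
      ∃ v, G.Adj c v ∧ G.dist r c = G.dist r v + 1 ∧ ¬ D.Adj c v
  · obtain ⟨c, hc, hmax, v, hcv, hd, hDcv⟩ := hA
    have hpar : ∀ y, G.Adj c y → y ≠ v → G.dist r y = G.dist r c + 1 := by
      intro y hy hyv
      rcases hstep hy with h' | h'
      · exact (hyv (parent_unique hG (r := r) hy.symm hcv.symm (by omega) (by omega))).elim
      · exact h'
    refine .of_centre hG h IH hc hcv hDcv (fun y hy => ?_) (fun w hcw => ?_)
      ⟨r, hr, (hroot c hmax).symm⟩
    · by_cases hyv : y = v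
      · exact .inl hyv
      · exact .inr (h.adj_or_isPendant hG hmax hy (hpar y hy hyv) le_rfl)
    · exact hbelow hc hmax hcw (hpar w (h.le hcw) (by rintro rfl; exact hDcv hcw))
  · push Not at hA
    obtain ⟨w, hcw', hdw⟩ := exists_parent hG (hroot c₁ hmax₁)
    have hcw := hA c₁ hc₁ hmax₁ w hcw' hdw
    have hwA := h.mem_left_of_mem_right hc₁ hcw
    obtain ⟨v, hwv, hdv⟩ := exists_parent hG (r := r) (x := w)
      (by rintro rfl; exact h.not_mem_both hwA hr)
    have hpar : ∀ y, G.Adj c₁ y → y ≠ w → G.dist r y = G.dist r c₁ + 1 := by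
      intro y hy hyw
      rcases hstep hy with h' | h'
      · exact (hyw (parent_unique hG (r := r) hy.symm hcw'.symm (by omega) (by omega))).elim
      · exact h'
    refine .of_leaf hG h IH hc₁ hcw hwv (by rintro rfl; omega) (fun y hy => ?_)
      (fun w' hcw' hne => hbelow hc₁ hmax₁ hcw' (hpar w' (h.le hcw') hne)) (fun y hy => ?_) ?_
      ⟨r, hr, (hroot c₁ hmax₁).symm⟩
    · by_cases hyw : y = w
      · exact .inl (hyw ▸ hcw)
      · exact h.adj_or_isPendant hG hmax₁ hy (hpar y hy hyw) le_rfl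
    · rcases hstep hy with h' | h'
      · exact .inr (.inl (parent_unique hG (r := r) hy.symm hwv.symm (by omega) (by omega)))
      · have hyA : y ∉ A₁ := fun h'' => h.indep hwA h'' hy
        by_cases hyA₂ : y ∈ A₂
        · -- `y` is another deepest centre, so its parent `w` lies in its star
          have := hA y hyA₂ (fun c' hc' => (hmax₁ c' hc').trans (by omega)) w hy.symm h'
          exact .inl ((h.leaf hwA).unique this.symm hcw.symm)
        · refine .inr (.inr ⟨hyA, hyA₂, hy, fun z hz => ?_⟩)
          have := h.dist_lt_of_deep hG hmax₁ hyA hyA₂ (by omega) hz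
          exact parent_unique hG (r := r) hz.symm hy this (by omega)
    · intro hp
      by_cases hvr : v = r
      · exact hp.2.1 (hvr ▸ hr)
      · obtain ⟨y, hvy, hdy⟩ := exists_parent hG hvr
        have := hp.2.2.2 y hvy
        subst this
        omega

end Build

end EdgeDom

theorem mainTheorem2 {V : Type u} [Finite V] [Nontrivial V] :
    (∀ G : SimpleGraph V, G.IsTree →
      (EdgeDom.totalEdgeDomNumber G = EdgeDom.edgeDomNumber G ↔
        ∃ T : EdgeDom.LGraph V, T.graph = G ∧ EdgeDom.FamilyTt T)) ∧
    (∀ T : EdgeDom.LGraph V, EdgeDom.FamilyTt T →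
      EdgeDom.IsMinTEDSet T.graph T.sEdges) := by
  refine ⟨fun G hG => ⟨fun heq => ?_, ?_⟩, fun T hT => ?_⟩
  · obtain ⟨D, A₁, A₂, h⟩ := EdgeDom.exists_isStarPacking hG.isAcyclic heq
    have hne : A₂.Nonempty := by
      obtain ⟨a⟩ := hG.connected.nonempty
      obtain ⟨b, hab⟩ := hG.connected.preconnected.exists_adj_of_nontrivial a
      have hcov : ∀ v, v ∈ A₁ ∨ v ∈ A₂ → A₂.Nonempty := by
        rintro v (hv | hv)
        · obtain ⟨c, hc, -⟩ := h.leaf hv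
          exact ⟨c, h.mem_right_of_mem_left hv hc⟩
        · exact ⟨v, hv⟩
      rcases h.cover hab with h' | h' | h' | h'
      exacts [hcov a (.inl h'), hcov a (.inr h'), hcov b (.inl h'), hcov b (.inr h')]
    obtain ⟨T, hTG, -, hT⟩ := h.hasFamilyLabelling hG hne
    exact ⟨T, hTG, hT⟩
  · rintro ⟨T, rfl, hT⟩
    exact hT.isLabelledPacking.totalEdgeDomNumber_eq
  · rw [T.sEdges_eq]
    exact hT.isLabelledPacking.isMinTEDSet
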